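/- Let $n\ge 2$, let $k\in\mathbb Z$, and let $(M^{2n},\omega,\theta)$ be a connected locally conformal symplectic manifold: $M$ is a connected smooth manifold of dimension $2n$, $\omega$ is a smooth non-degenerate $2$-form and $\theta$ a smooth $1$-form on $M$ with $d\theta=0$ and $d\omega+\theta\wedge\omega=0$. Put $d_k\alpha=d\alpha+k\theta\wedge\alpha$ (so $d_\theta=d_1$) and $L\alpha=\omega\wedge\alpha$ on $\Omega^*(M)$, and let $H^q(\Omega^*(M),d_k)$ be the cohomology of $(\Omega^*(M),d_k)$. Let $\mathcal P^q(M)$ be the space of smooth primitive $q$-forms, i.e. of the $\alpha\in\Omega^q(M)$ with $L^{n-q+1}\alpha=0$ if $q\le n$, and $\alpha=0$ if $q>n$. Let $d_k^+=\Pi_{pr}d_k$, where $\Pi_{pr}$ is the projection of $\Omega^*(M)=\mathcal P^*(M)\oplus L\Omega^*(M)$ onto $\mathcal P^*(M)$, and $$H^1(\mathcal P^*(M),d_k^+)=\frac{\ker\big(d_k^+:\mathcal P^1(M)\to\mathcal P^2(M)\big)}{d_k^+(\mathcal P^0(M))}.$$ 1. If $[(k-1)\theta]\ne 0$ in $H^1(M,\mathbb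 R)$, then $H^1(\mathcal P^*(M),d_k^+)=H^1(\Omega^*(M),d_k)$: every $\alpha\in\mathcal P^1(M)$ with $d_k^+\alpha=0$ satisfies $d_k\alpha=0$, and $[\alpha]\mapsto[\alpha]$ is an isomorphism. 2. If $[(k-1)\theta]=0$ in $H^1(M,\mathbb R)$, then there is $h\in C^\infty(M)$ with $dh=-(k-1)\theta$, and for each such $h$ the following holds. a) If $[\omega]\ne 0$ in $H^2(\Omega^*(M),d_\theta)$, then $H^1(\mathcal P^*(M),d_k^+)\cong H^1(\Omega^*(M),d_\theta)$, by $[\alpha]\mapsto[e^{-h}\alpha]$. b) If $[\omega]=0$ in $H^2(\Omega^*(M),d_\theta)$, then $H^1(\mathcal P^*(M),d_k^+)\cong H^1(\Omega^*(M),d_\theta)\oplus\mathbb R$. More precisely, there is $\rho\in\mathcal P^1(M)$ with $d_k^+\rho=0$ and $d_k\rho=e^h\omega$, and for each such $\rho$ the map $([\beta],c)\mapsto[e^h\beta+c\rho]$ is an isomorphism from $H^1(\Omega^*(M),d_\theta)\oplus\mathbb R$ onto $H^1(\mathcal P^*(M),d_k^+)$. -/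

import Mathlib

open scoped Manifold Nat

noncomputable section

namespace LCS

section Wedge

variable {V : Type*} [AddCommGroup V] [Module ℝ V] [TopologicalSpace V]

/-- The continuous multilinear map `v ↦ α (v₁, …, v_p) * β (v_{p+1}, …, v_{p+q})`. -/
def mulForm {p q m : ℕ} (h : p + q = m) (α : V [⋀^Fin p]→L[ℝ] ℝ) (β : V [⋀^Fin q]→L[ℝ] ℝ) :
    ContinuousMultilinearMap ℝ (fun _ : Fin m => V) ℝ where
  toMultilinearMap :=
    ((LinearMap.mul' ℝ ℝ).compMultilinearMap
      (MultilinearMap.domCoprod α.toMultilinearMap β.toMultilinearMap)).domDomCongr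
        (finSumFinEquiv.trans (finCongr h))
  cont := by
    change Continuous fun v : Fin m → V =>
      α (fun i => v (finCongr h (finSumFinEquiv (Sum.inl i)))) *
        β (fun i => v (finCongr h (finSumFinEquiv (Sum.inr i))))
    exact (α.cont.comp (by fun_prop)).mul (β.cont.comp (by fun_prop))

/-- The wedge product of alternating forms,
`(α ∧ β)(v₁, …, v_{p+q}) =
  1 / (p! q!) ∑_σ sign σ * α (v_{σ 1}, …, v_{σ p}) * β (v_{σ (p+1)}, …, v_{σ (p+q)})`
(see `wedge_apply`). The target degree `m` is any number that is equal to `p + q`. -/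
def wedge {p q m : ℕ} (h : p + q = m) (α : V [⋀^Fin p]→L[ℝ] ℝ) (β : V [⋀^Fin q]→L[ℝ] ℝ) :
    V [⋀^Fin m]→L[ℝ] ℝ :=
  ((p ! : ℝ) * (q ! : ℝ))⁻¹ • ContinuousMultilinearMap.alternatization (mulForm h α β)

theorem wedge_apply {p q m : ℕ} (h : p + q = m) (α : V [⋀^Fin p]→L[ℝ] ℝ)
    (β : V [⋀^Fin q]→L[ℝ] ℝ) (v : Fin m → V) :
    wedge h α β v = ((p ! : ℝ) * (q ! : ℝ))⁻¹ * ∑ σ : Equiv.Perm (Fin m),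
      (((Equiv.Perm.sign σ : ℤˣ) : ℤ) : ℝ) *
        (α (fun i => v (σ (Fin.cast h (Fin.castAdd q i)))) *
          β (fun i => v (σ (Fin.cast h (Fin.natAdd p i))))) := by
  change _ * ContinuousMultilinearMap.alternatization (mulForm h α β) v = _
  rw [ContinuousMultilinearMap.alternatization_apply_apply]
  congr 1
  refine Finset.sum_congr rfl fun σ _ => ?_
  rw [Units.smul_def, zsmul_eq_mul]
  rfl

theorem wedge_add {p q m : ℕ} (h : p + q = m) (α : V [⋀^Fin p]→L[ℝ] ℝ)
    (β γ : V [⋀^Fin q]→L[ℝ] ℝ) : wedge h α (β + γ) = wedge h α β + wedge h α γ := by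
  ext v
  simp [wedge_apply, mul_add, Finset.sum_add_distrib]

theorem wedge_smul {p q m : ℕ} (h : p + q = m) (c : ℝ) (α : V [⋀^Fin p]→L[ℝ] ℝ)
    (β : V [⋀^Fin q]→L[ℝ] ℝ) : wedge h α (c • β) = c • wedge h α β := by
  ext v
  simp [wedge_apply, Finset.mul_sum, mul_left_comm]

theorem zero_wedge {p q m : ℕ} (h : p + q = m) (β : V [⋀^Fin q]→L[ℝ] ℝ) :
    wedge h (0 : V [⋀^Fin p]→L[ℝ] ℝ) β = 0 := by
  ext v
  simp [wedge_apply]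

end Wedge

section Forms

variable (n : ℕ) (M : Type*) [TopologicalSpace M]
  [ChartedSpace (EuclideanSpace ℝ (Fin (2 * n))) M]

/-- The model space `ℝ^{2n}`. -/
abbrev Model : Type := EuclideanSpace ℝ (Fin (2 * n))

/-- Fields of alternating `q`-forms on the tangent spaces of a `2n`-dimensional manifold `M`,
without any condition of smoothness. -/
def Form (q : ℕ) : Type _ :=
  (x : M) → TangentSpace 𝓘(ℝ, Model n) x [⋀^Fin q]→L[ℝ] ℝ

instance (q : ℕ) : AddCommGroup (Form n M q) :=
  inferInstanceAs
    (AddCommGroup ((x : M) → TangentSpace 𝓘(ℝ, Model n) x [⋀^Fin q]→L[ℝ] ℝ))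

instance (q : ℕ) : Module ℝ (Form n M q) :=
  inferInstanceAs
    (Module ℝ ((x : M) → TangentSpace 𝓘(ℝ, Model n) x [⋀^Fin q]→L[ℝ] ℝ))

variable {n M}

theorem Form.add_apply {q : ℕ} (α β : Form n M q) (x : M) : (α + β) x = α x + β x := rfl

theorem Form.smul_apply {q : ℕ} (c : ℝ) (α : Form n M q) (x : M) : (c • α) x = c • α x := rfl

theorem Form.zero_apply {q : ℕ} (x : M) : (0 : Form n M q) x = 0 := rfl

/-- The expression of a form in the preferred chart at `x₀`: its pullback along the inverse of
the chart. -/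
def Form.inChart {q : ℕ} (α : Form n M q) (x₀ : M) (y : Model n) : Model n [⋀^Fin q]→L[ℝ] ℝ :=
  (α ((extChartAt 𝓘(ℝ, Model n) x₀).symm y)).compContinuousLinearMap
    (mfderiv 𝓘(ℝ, Model n) 𝓘(ℝ, Model n) (extChartAt 𝓘(ℝ, Model n) x₀).symm y)

theorem Form.inChart_add {q : ℕ} (α β : Form n M q) (x₀ : M) :
    (α + β).inChart x₀ = α.inChart x₀ + β.inChart x₀ := rfl

theorem Form.inChart_smul {q : ℕ} (c : ℝ) (α : Form n M q) (x₀ : M) :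
    (c • α).inChart x₀ = c • α.inChart x₀ := rfl

theorem Form.inChart_zero {q : ℕ} (x₀ : M) : (0 : Form n M q).inChart x₀ = 0 := rfl

variable (n M) in
/-- `Ω^q(M)`: the smooth `q`-forms, i.e. those whose expressions in charts are `C^∞`. -/
def smoothForms (q : ℕ) : Submodule ℝ (Form n M q) where
  carrier := {α | ∀ x₀ : M,
    ContDiffOn ℝ (⊤ : ℕ∞) (α.inChart x₀) (extChartAt 𝓘(ℝ, Model n) x₀).target}
  add_mem' := fun ha hb x₀ => (ha x₀).add (hb x₀)
  zero_mem' := fun x₀ => by rw [Form.inChart_zero]; exact contDiffOn_const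
  smul_mem' := fun c _ ha x₀ => (ha x₀).const_smul c

/-- The exterior derivative, computed in the preferred chart at each point. -/
def extD {q : ℕ} (α : Form n M q) : Form n M (q + 1) := fun x =>
  (extDeriv (α.inChart x) (extChartAt 𝓘(ℝ, Model n) x x)).compContinuousLinearMap
    (mfderiv 𝓘(ℝ, Model n) 𝓘(ℝ, Model n) (extChartAt 𝓘(ℝ, Model n) x) x)

theorem differentiableAt_inChart {q : ℕ} {α : Form n M q} (hα : α ∈ smoothForms n M q) (x : M) :
    DifferentiableAt ℝ (α.inChart x) (extChartAt 𝓘(ℝ, Model n) x x) :=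
  ((hα x).contDiffAt (extChartAt_target_mem_nhds x)).differentiableAt (by simp)

theorem extD_add {q : ℕ} {α β : Form n M q} (hα : α ∈ smoothForms n M q)
    (hβ : β ∈ smoothForms n M q) : extD (α + β) = extD α + extD β := by
  funext x
  simp only [extD, Form.inChart_add, Form.add_apply,
    extDeriv_add (differentiableAt_inChart hα x) (differentiableAt_inChart hβ x)]
  rfl

theorem extD_smul {q : ℕ} (c : ℝ) (α : Form n M q) : extD (c • α) = c • extD α := by
  funext x
  simp only [extD, Form.inChart_smul, Form.smul_apply, extDeriv_smul]
  rfl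

/-- The twisted differential `d_η α = dα + η ∧ α` of a `1`-form `η`. With `η = k θ` this is the
operator `d_k`. -/
def twistedD (η : Form n M 1) {q : ℕ} (α : Form n M q) : Form n M (q + 1) :=
  fun x => extD α x + wedge (Nat.add_comm 1 q) (η x) (α x)

theorem twistedD_add (η : Form n M 1) {q : ℕ} {α β : Form n M q} (hα : α ∈ smoothForms n M q)
    (hβ : β ∈ smoothForms n M q) : twistedD η (α + β) = twistedD η α + twistedD η β := by
  funext x
  simp only [twistedD, extD_add hα hβ, Form.add_apply, wedge_add]
  abel

theorem twistedD_smul (η : Form n M 1) {q : ℕ} (c : ℝ) (α : Form n M q) :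
    twistedD η (c • α) = c • twistedD η α := by
  funext x
  simp only [twistedD, extD_smul, Form.smul_apply, wedge_smul, smul_add]

theorem twistedD_zero_form (η : Form n M 1) {q : ℕ} : twistedD η (0 : Form n M q) = 0 := by
  simpa using twistedD_smul η 0 (0 : Form n M q)

theorem twistedD_zero {q : ℕ} (α : Form n M q) : twistedD 0 α = extD α := by
  funext x
  simp only [twistedD, Form.zero_apply, zero_wedge, add_zero]

/-- A function, seen as a `0`-form. -/
def ofFun (f : M → ℝ) : Form n M 0 := fun x =>
  ContinuousAlternatingMap.constOfIsEmpty ℝ (TangentSpace 𝓘(ℝ, Model n) x) (Fin 0) (f x)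

/-- The product of a function and a form. -/
def mulFun {q : ℕ} (f : M → ℝ) (α : Form n M q) : Form n M q := fun x => f x • α x

end Forms

section Cohomology

variable {n : ℕ} {M : Type*} [TopologicalSpace M]
  [ChartedSpace (EuclideanSpace ℝ (Fin (2 * n))) M]

/-- The smooth `q`-forms `α` with `d_η α = 0`. -/
def cocycles (η : Form n M 1) (q : ℕ) : Submodule ℝ (Form n M q) where
  carrier := {α | α ∈ smoothForms n M q ∧ twistedD η α = 0}
  add_mem' := fun ha hb =>
    ⟨add_mem ha.1 hb.1, by rw [twistedD_add η ha.1 hb.1, ha.2, hb.2, add_zero]⟩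
  zero_mem' := ⟨zero_mem _, twistedD_zero_form η⟩
  smul_mem' := fun c _ ha =>
    ⟨Submodule.smul_mem _ c ha.1, by rw [twistedD_smul, ha.2, smul_zero]⟩

/-- The image `d_η (Ω^{q-1}(M))`, where `Ω^{-1}(M) = 0`. -/
def coboundaries (η : Form n M 1) : (q : ℕ) → Submodule ℝ (Form n M q)
  | 0 => ⊥
  | q + 1 =>
    { carrier := {α | ∃ β ∈ smoothForms n M q, twistedD η β = α}
      add_mem' := by
        rintro _ _ ⟨β, hβ, rfl⟩ ⟨γ, hγ, rfl⟩
        exact ⟨β + γ, add_mem hβ hγ, twistedD_add η hβ hγ⟩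
      zero_mem' := ⟨0, zero_mem _, twistedD_zero_form η⟩
      smul_mem' := by
        rintro c _ ⟨β, hβ, rfl⟩
        exact ⟨c • β, Submodule.smul_mem _ c hβ, twistedD_smul η c β⟩ }

/-- `H^q(Ω^*(M), d_η)`, for a closed `1`-form `η`: closed forms modulo exact ones. -/
abbrev Cohomology (η : Form n M 1) (q : ℕ) : Type _ :=
  cocycles η q ⧸ (coboundaries η q).comap (cocycles η q).subtype

/-- The class in `H^q(Ω^*(M), d_η)` of a `d_η`-closed form. -/
def cohomologyClass (η : Form n M 1) {q : ℕ} (α : cocycles η q) : Cohomology η q :=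
  Submodule.Quotient.mk α

variable (n M) in
/-- `H^q(M, ℝ)`, as de Rham cohomology. -/
abbrev DeRham (q : ℕ) : Type _ := Cohomology (0 : Form n M 1) q

end Cohomology

section Primitive

variable {n : ℕ} {M : Type*} [TopologicalSpace M]
  [ChartedSpace (EuclideanSpace ℝ (Fin (2 * n))) M]

/-- The Lefschetz operator `L α = ω ∧ α`. -/
def lef (ω : Form n M 2) {q : ℕ} (α : Form n M q) : Form n M (q + 2) := fun x =>
  wedge (Nat.add_comm 2 q) (ω x) (α x)

theorem lef_add (ω : Form n M 2) {q : ℕ} (α β : Form n M q) :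
    lef ω (α + β) = lef ω α + lef ω β :=
  funext fun _ => wedge_add _ _ _ _

theorem lef_smul (ω : Form n M 2) {q : ℕ} (c : ℝ) (α : Form n M q) :
    lef ω (c • α) = c • lef ω α :=
  funext fun _ => wedge_smul _ _ _ _

/-- The iterates `L^j`. -/
def lefPow (ω : Form n M 2) {q : ℕ} : (j : ℕ) → Form n M q → Form n M (q + 2 * j)
  | 0, α => α
  | j + 1, α => lef ω (lefPow ω j α)

theorem lefPow_add (ω : Form n M 2) {q : ℕ} (j : ℕ) (α β : Form n M q) :
    lefPow ω j (α + β) = lefPow ω j α + lefPow ω j β := by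
  induction j with
  | zero => rfl
  | succ j ih =>
    change lef ω (lefPow ω j (α + β)) = lef ω (lefPow ω j α) + lef ω (lefPow ω j β)
    rw [ih, lef_add]

theorem lefPow_smul (ω : Form n M 2) {q : ℕ} (j : ℕ) (c : ℝ) (α : Form n M q) :
    lefPow ω j (c • α) = c • lefPow ω j α := by
  induction j with
  | zero => rfl
  | succ j ih =>
    change lef ω (lefPow ω j (c • α)) = c • lef ω (lefPow ω j α)
    rw [ih, lef_smul]

/-- `P^q(M)`: the smooth `q`-forms that are primitive at every point, i.e. satisfy
`L^{n-q+1} α = 0` if `q ≤ n`, and vanish if `q > n`. -/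
def primitiveForms (ω : Form n M 2) (q : ℕ) : Submodule ℝ (Form n M q) where
  carrier := {α | α ∈ smoothForms n M q ∧
    (q ≤ n → lefPow ω (n - q + 1) α = 0) ∧ (n < q → α = 0)}
  add_mem' := fun {a b} ha hb => ⟨add_mem ha.1 hb.1,
    fun h => by rw [lefPow_add, ha.2.1 h, hb.2.1 h, add_zero],
    fun h => by rw [ha.2.2 h, hb.2.2 h, add_zero]⟩
  zero_mem' := ⟨zero_mem _,
    fun _ => by simpa using lefPow_smul ω (n - q + 1) 0 (0 : Form n M q), fun _ => rfl⟩
  smul_mem' := fun c _ ha => ⟨Submodule.smul_mem _ c ha.1,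
    fun h => by rw [lefPow_smul, ha.2.1 h, smul_zero],
    fun h => by rw [ha.2.2 h, smul_zero]⟩

/-- The degree `q` part `L Ω^{q-2}(M)` of `L Ω^*(M)`; it is zero for `q < 2`. -/
def lefschetzForms (ω : Form n M 2) : (q : ℕ) → Submodule ℝ (Form n M q)
  | 0 => ⊥
  | 1 => ⊥
  | q + 2 =>
    { carrier := {α | ∃ γ ∈ smoothForms n M q, lef ω γ = α}
      add_mem' := by
        rintro _ _ ⟨β, hβ, rfl⟩ ⟨γ, hγ, rfl⟩
        exact ⟨β + γ, add_mem hβ hγ, lef_add ω β γ⟩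
      zero_mem' := ⟨0, zero_mem _, by simpa using lef_smul ω 0 (0 : Form n M q)⟩
      smul_mem' := by
        rintro c _ ⟨β, hβ, rfl⟩
        exact ⟨c • β, Submodule.smul_mem _ c hβ, lef_smul ω c β⟩ }

/-- `Π_pr α = β` for the projection `Π_pr` of `Ω^* = P^* ⊕ L Ω^*` onto its first summand:
the form `β` is primitive and `α - β` lies in `L Ω^*`. -/
def IsPrimitivePart (ω : Form n M 2) {q : ℕ} (α β : Form n M q) : Prop :=
  β ∈ primitiveForms ω q ∧ α - β ∈ lefschetzForms ω q

/-- `d_η^+ α = β`, where `d_η^+ = Π_pr d_η`. -/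
def IsPlusD (ω : Form n M 2) (η : Form n M 1) {q : ℕ} (α : Form n M q) (β : Form n M (q + 1)) :
    Prop :=
  IsPrimitivePart ω (twistedD η α) β

theorem IsPlusD.add {ω : Form n M 2} {η : Form n M 1} {q : ℕ} {α α' : Form n M q}
    {β β' : Form n M (q + 1)} (hα : α ∈ smoothForms n M q) (hα' : α' ∈ smoothForms n M q)
    (h : IsPlusD ω η α β) (h' : IsPlusD ω η α' β') : IsPlusD ω η (α + α') (β + β') := by
  refine ⟨add_mem h.1 h'.1, ?_⟩
  rw [twistedD_add η hα hα', add_sub_add_comm]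
  exact add_mem h.2 h'.2

theorem IsPlusD.smul {ω : Form n M 2} {η : Form n M 1} {q : ℕ} {α : Form n M q}
    {β : Form n M (q + 1)} (c : ℝ) (h : IsPlusD ω η α β) : IsPlusD ω η (c • α) (c • β) := by
  refine ⟨Submodule.smul_mem _ c h.1, ?_⟩
  rw [twistedD_smul, ← smul_sub]
  exact Submodule.smul_mem _ c h.2

theorem IsPlusD.zero (ω : Form n M 2) (η : Form n M 1) (q : ℕ) :
    IsPlusD ω η (0 : Form n M q) 0 := by
  refine ⟨zero_mem _, ?_⟩
  rw [twistedD_zero_form, sub_zero]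
  exact zero_mem _

/-- The kernel of `d_η^+ : P^q(M) → P^{q+1}(M)`. -/
def plusCocycles (ω : Form n M 2) (η : Form n M 1) (q : ℕ) : Submodule ℝ (Form n M q) where
  carrier := {α | α ∈ primitiveForms ω q ∧ IsPlusD ω η α 0}
  add_mem' := fun ha hb =>
    ⟨add_mem ha.1 hb.1, by simpa using ha.2.add ha.1.1 hb.1.1 hb.2⟩
  zero_mem' := ⟨zero_mem _, IsPlusD.zero ω η q⟩
  smul_mem' := fun c _ ha =>
    ⟨Submodule.smul_mem _ c ha.1, by simpa using ha.2.smul c⟩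

/-- The image `d_η^+ (P^{q-1}(M))`, where `P^{-1}(M) = 0`. -/
def plusCoboundaries (ω : Form n M 2) (η : Form n M 1) : (q : ℕ) → Submodule ℝ (Form n M q)
  | 0 => ⊥
  | q + 1 =>
    { carrier := {α | ∃ β ∈ primitiveForms ω q, IsPlusD ω η β α}
      add_mem' := by
        rintro _ _ ⟨β, hβ, h⟩ ⟨γ, hγ, h'⟩
        exact ⟨β + γ, add_mem hβ hγ, h.add hβ.1 hγ.1 h'⟩
      zero_mem' := ⟨0, zero_mem _, IsPlusD.zero ω η q⟩
      smul_mem' := by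
        rintro c _ ⟨β, hβ, h⟩
        exact ⟨c • β, Submodule.smul_mem _ c hβ, h.smul c⟩ }

/-- The plus-primitive cohomology `H^q(P^*(M), d_η^+)`, `q ≤ n - 1`. -/
abbrev PlusCohomology (ω : Form n M 2) (η : Form n M 1) (q : ℕ) : Type _ :=
  plusCocycles ω η q ⧸ (plusCoboundaries ω η q).comap (plusCocycles ω η q).subtype

/-- The class in `H^q(P^*(M), d_η^+)` of a primitive form in the kernel of `d_η^+`. -/
def plusClass (ω : Form n M 2) (η : Form n M 1) {q : ℕ} (α : plusCocycles ω η q) :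
    PlusCohomology ω η q :=
  Submodule.Quotient.mk α

/-- `(M, ω, θ)` is locally conformal symplectic: `ω` is a smooth non-degenerate `2`-form and `θ`
a smooth `1`-form with `dθ = 0` and `dω + θ ∧ ω = 0`. -/
structure IsLCS (ω : Form n M 2) (θ : Form n M 1) : Prop where
  smooth_form : ω ∈ smoothForms n M 2
  smooth_lee : θ ∈ smoothForms n M 1
  nondegenerate : ∀ (x : M) (v : TangentSpace 𝓘(ℝ, Model n) x),
    (∀ w : TangentSpace 𝓘(ℝ, Model n) x, ω x ![v, w] = 0) → v = 0
  closed_lee : extD θ = 0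
  closed_form : twistedD θ ω = 0

/-- `ω` as a `d_θ`-closed form. -/
def IsLCS.formCocycle {ω : Form n M 2} {θ : Form n M 1} (h : IsLCS ω θ) : cocycles θ 2 :=
  ⟨ω, h.smooth_form, h.closed_form⟩

/-- `c θ` as a `d`-closed form. -/
def IsLCS.leeCocycle {ω : Form n M 2} {θ : Form n M 1} (h : IsLCS ω θ) (c : ℝ) :
    cocycles (0 : Form n M 1) 1 :=
  ⟨c • θ, Submodule.smul_mem _ c h.smooth_lee, by
    rw [twistedD_zero, extD_smul, h.closed_lee, smul_zero]⟩

/-- The class `[c θ]` in `H^1(M, ℝ)`. -/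
def IsLCS.leeClass {ω : Form n M 2} {θ : Form n M 1} (h : IsLCS ω θ) (c : ℝ) : DeRham n M 1 :=
  cohomologyClass 0 (h.leeCocycle c)

/-- The class `[ω]` in `H^2(Ω^*(M), d_θ)`. -/
def IsLCS.formClass {ω : Form n M 2} {θ : Form n M 1} (h : IsLCS ω θ) : Cohomology θ 2 :=
  cohomologyClass θ h.formCocycle

end Primitive

end LCS

end

/-! Every function and every `1`-form is primitive for degree reasons, and the degree `2` part of `L
Ω^*` is `C^∞(M) ω`. So `α` lies in the kernel of `d_k^+` exactly when `d_k α = f ω` for some smooth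
`f` (`mem_plusCocycles_one`), and the coboundaries in degree `1` are those of `d_k`
(`plusCoboundaries_one`). Everything rests on which `f` can occur.

Applying `d_k` to `d_k α = f ω` gives `(df + (k - 1) f θ) ∧ ω = 0`. Since `n ≥ 2`, wedging `1`-forms
with the nondegenerate `ω` is injective, hence `df = -(k - 1) f θ`
(`IsLCS.extD_ofFun_of_twistedD_eq`). This is a linear equation for `f`, so on a connected manifold
`f` vanishes identically or nowhere (`eq_zero_of_extD_ofFun_eq`). If it vanishes nowhere, then `(k -
1) θ = d(-log |f|)` is exact. Hence `f = 0` in case 1, and the two cohomologies have the same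
cocycles and coboundaries.

If `dh = -(k - 1) θ`, then `f = c e^h` with `c` constant (`exists_eq_mul_exp`). Since `k θ + dh =
θ`, multiplication by `e^h` carries `d_θ` to `d_k` (`twistedD_mulFun_exp`), and `d_θ (e^{-h} α) = c
ω`. If `[ω] ≠ 0` this forces `c = 0`. If `ω = d_θ β`, then `ρ = e^h β` realizes `c = 1`, and `c` is
the coordinate on the extra summand `ℝ`; it is well defined on classes because `d_k² = 0` and `ω ≠
0`. -/

namespace LCS

/-! ### Pointwise algebra of the wedge product. -/

section WedgeAlgebra

variable {V W : Type*} [AddCommGroup V] [Module ℝ V] [TopologicalSpace V]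
  [AddCommGroup W] [Module ℝ W] [TopologicalSpace W]

theorem add_wedge {p q m : ℕ} (h : p + q = m) (α β : V [⋀^Fin p]→L[ℝ] ℝ)
    (γ : V [⋀^Fin q]→L[ℝ] ℝ) : wedge h (α + β) γ = wedge h α γ + wedge h β γ := by
  ext v
  simp [wedge_apply, add_mul, mul_add, Finset.sum_add_distrib]

theorem smul_wedge {p q m : ℕ} (h : p + q = m) (c : ℝ) (α : V [⋀^Fin p]→L[ℝ] ℝ)
    (β : V [⋀^Fin q]→L[ℝ] ℝ) : wedge h (c • α) β = c • wedge h α β := by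
  ext v
  simp [wedge_apply, Finset.mul_sum, mul_left_comm, mul_assoc]

theorem wedge_compContinuousLinearMap {p q m : ℕ} (h : p + q = m) (α : V [⋀^Fin p]→L[ℝ] ℝ)
    (β : V [⋀^Fin q]→L[ℝ] ℝ) (f : W →L[ℝ] V) :
    (wedge h α β).compContinuousLinearMap f =
      wedge h (α.compContinuousLinearMap f) (β.compContinuousLinearMap f) := by
  ext v
  simp only [wedge_apply, ContinuousAlternatingMap.compContinuousLinearMap_apply]
  rfl

/-- The wedge product with a `0`-form on the right is multiplication by its value. -/
theorem wedge_zero_form {p : ℕ} (h : p + 0 = p) (α : V [⋀^Fin p]→L[ℝ] ℝ)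
    (β : V [⋀^Fin 0]→L[ℝ] ℝ) : wedge h α β = β ![] • α := by
  ext v
  rw [wedge_apply]
  have key : ∀ σ : Equiv.Perm (Fin p), (((Equiv.Perm.sign σ : ℤˣ) : ℤ) : ℝ) *
        (α (fun i => v (σ (Fin.cast h (Fin.castAdd 0 i)))) *
          β (fun i => v (σ (Fin.cast h (Fin.natAdd p i))))) = β ![] * α v := by
    intro σ
    have h1 : α (fun i => v (σ (Fin.cast h (Fin.castAdd 0 i)))) =
        (((Equiv.Perm.sign σ : ℤˣ) : ℤ) : ℝ) * α v := by
      have := α.toAlternatingMap.map_perm v σ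
      rw [Units.smul_def, zsmul_eq_mul] at this
      exact this
    have h2 : (fun i => v (σ (Fin.cast h (Fin.natAdd p i)))) = ![] := Subsingleton.elim _ _
    rw [h1, h2]
    rcases Int.units_eq_one_or (Equiv.Perm.sign σ) with hs | hs <;> rw [hs] <;> push_cast <;> ring
  rw [Finset.sum_congr rfl fun σ _ => key σ]
  simp [Fintype.card_perm, Nat.factorial_ne_zero]

/-- The wedge product with a `1`-form on the left, as an alternating sum. -/
theorem one_form_wedge_apply {q : ℕ} (h : 1 + q = q + 1) (t : V [⋀^Fin 1]→L[ℝ] ℝ)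
    (α : V [⋀^Fin q]→L[ℝ] ℝ) (v : Fin (q + 1) → V) :
    wedge h t α v = ∑ i : Fin (q + 1), (-1 : ℝ) ^ (i : ℕ) * (t ![v i] * α (i.removeNth v)) := by
  -- A permutation of `Fin (q + 1)` is a pair `(i, e)`: the image `i` of `0` and a permutation `e`
  -- of the rest. The `q!` choices of `e` contribute equally, which cancels the normalization.
  rw [wedge_apply, ← (Equiv.Perm.decomposeFin.symm).sum_comp, Fintype.sum_prod_type]
  rw [Finset.mul_sum]
  refine Finset.sum_congr rfl fun i _ => ?_
  have key : ∀ e : Equiv.Perm (Fin q),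
      (((Equiv.Perm.sign (Equiv.Perm.decomposeFin.symm (i, e)) : ℤˣ) : ℤ) : ℝ) *
        (t (fun j => v (Equiv.Perm.decomposeFin.symm (i, e) (Fin.cast h (Fin.castAdd q j)))) *
          α (fun j => v (Equiv.Perm.decomposeFin.symm (i, e) (Fin.cast h (Fin.natAdd 1 j))))) =
      (-1 : ℝ) ^ (i : ℕ) * (t ![v i] * α (i.removeNth v)) := by
    intro e
    have h1 : (fun j => v (Equiv.Perm.decomposeFin.symm (i, e) (Fin.cast h (Fin.castAdd q j)))) =
        ![v i] := by
      funext j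
      have : Fin.cast h (Fin.castAdd q j) = 0 := by
        ext; simp
      rw [this]; simp
    have h2 : ∀ j : Fin q, Fin.cast h (Fin.natAdd 1 j) = j.succ := by
      intro j; ext; simp
    simp only [h1, h2, Equiv.Perm.decomposeFin_symm_apply_succ, Equiv.Perm.decomposeFin.symm_sign]
    have h3 : α (fun j => v (Equiv.swap 0 i (e j).succ)) =
        (((Equiv.Perm.sign e : ℤˣ) : ℤ) : ℝ) * α (fun j => v (Equiv.swap 0 i j.succ)) := by
      have := α.toAlternatingMap.map_perm (fun j => v (Equiv.swap 0 i j.succ)) e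
      rw [Units.smul_def, zsmul_eq_mul] at this
      exact this
    rw [h3]
    refine Fin.cases ?_ (fun i => ?_) i
    · have h4 : (fun j : Fin q => v (Equiv.swap 0 0 j.succ)) = (0 : Fin (q+1)).removeNth v := by
        funext j; simp [Fin.removeNth]
      rw [h4]
      rcases Int.units_eq_one_or (Equiv.Perm.sign e) with hs | hs <;> rw [hs] <;> simp
    -- The transposition leaves the remaining vectors in a different order from `removeNth`; the two
    -- orders differ by a cycle of sign `(-1)^i`, and the sign of the transposition supplies the
    -- last factor.
    · have h4 : α (fun j => v (Equiv.swap 0 i.succ j.succ)) =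
          (-1 : ℝ) ^ (i : ℕ) * α (i.succ.removeNth v) := by
        have := α.toAlternatingMap.map_perm (i.succ.removeNth v) i.cycleRange
        rw [Units.smul_def, zsmul_eq_mul, Fin.sign_cycleRange] at this
        push_cast at this
        refine Eq.trans ?_ this
        change _ = α fun j => v (i.succ.succAbove (i.cycleRange j))
        simp only [Fin.succAbove_cycleRange]
      rw [h4]
      rcases Int.units_eq_one_or (Equiv.Perm.sign e) with hs | hs <;> rw [hs] <;>
        simp [pow_succ] <;> ring
  rw [Finset.sum_congr rfl fun σ _ => key σ]
  have : ((q ! : ℕ) : ℝ) ≠ 0 := by exact_mod_cast q.factorial_ne_zero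
  simp [Fintype.card_perm]
  field_simp

theorem one_form_wedge_one_form_apply (h : 1 + 1 = 2) (t α : V [⋀^Fin 1]→L[ℝ] ℝ) (u v : V) :
    wedge h t α ![u, v] = t ![u] * α ![v] - t ![v] * α ![u] := by
  rw [one_form_wedge_apply, Fin.sum_univ_two]
  have h0 : (0 : Fin 2).removeNth ![u, v] = ![v] := by
    ext i; fin_cases i; rfl
  have h1 : (1 : Fin 2).removeNth ![u, v] = ![u] := by
    ext i; fin_cases i; rfl
  rw [h0, h1]
  simp
  ring

theorem one_form_wedge_two_form_apply (h : 1 + 2 = 3) (t : V [⋀^Fin 1]→L[ℝ] ℝ)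
    (α : V [⋀^Fin 2]→L[ℝ] ℝ) (u v w : V) :
    wedge h t α ![u, v, w] =
      t ![u] * α ![v, w] - t ![v] * α ![u, w] + t ![w] * α ![u, v] := by
  rw [one_form_wedge_apply, Fin.sum_univ_three]
  have h0 : (0 : Fin 3).removeNth ![u, v, w] = ![v, w] := by
    ext i; fin_cases i <;> rfl
  have h1 : (1 : Fin 3).removeNth ![u, v, w] = ![u, w] := by
    ext i; fin_cases i <;> rfl
  have h2 : (2 : Fin 3).removeNth ![u, v, w] = ![u, v] := by
    ext i; fin_cases i <;> rfl
  rw [h0, h1, h2]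
  simp
  ring

theorem one_form_wedge_one_form_wedge_self (t α : V [⋀^Fin 1]→L[ℝ] ℝ) :
    wedge (Nat.add_comm 1 2) t (wedge (Nat.add_comm 1 1) t α) = 0 := by
  ext v
  have hv : v = ![v 0, v 1, v 2] := by
    ext i; fin_cases i <;> rfl
  rw [hv, one_form_wedge_two_form_apply]
  simp only [one_form_wedge_one_form_apply]
  change _ = (0 : ℝ)
  ring

theorem one_form_wedge_self (t : V [⋀^Fin 1]→L[ℝ] ℝ) : wedge (Nat.add_comm 1 1) t t = 0 := by
  ext v
  have hv : v = ![v 0, v 1] := by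
    ext i; fin_cases i <;> rfl
  rw [hv, one_form_wedge_one_form_apply, mul_comm, sub_self]
  rfl

theorem one_form_wedge_antisymm (t s : V [⋀^Fin 1]→L[ℝ] ℝ) :
    wedge (Nat.add_comm 1 1) t s = -wedge (Nat.add_comm 1 1) s t := by
  ext v
  have hv : v = ![v 0, v 1] := by
    ext i; fin_cases i <;> rfl
  change _ = -(wedge (Nat.add_comm 1 1) s t v)
  rw [hv, one_form_wedge_one_form_apply, one_form_wedge_one_form_apply]
  ring

theorem one_form_ext {t s : V [⋀^Fin 1]→L[ℝ] ℝ} (h : ∀ v, t ![v] = s ![v]) : t = s := by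
  ext v
  have hv : v = ![v 0] := by
    ext i; fin_cases i; rfl
  rw [hv, h]

/-- Wedging a `1`-form with a nondegenerate `2`-form is injective in dimension at least `3`. -/
theorem eq_zero_of_wedge_nondegenerate (hdim : 3 ≤ Module.finrank ℝ V)
    (β : V [⋀^Fin 1]→L[ℝ] ℝ) (w : V [⋀^Fin 2]→L[ℝ] ℝ)
    (hw : ∀ v, (∀ u, w ![v, u] = 0) → v = 0) (h : wedge (Nat.add_comm 1 2) β w = 0) : β = 0 := by
  by_contra hβ
  obtain ⟨u, hu⟩ : ∃ u, β ![u] ≠ 0 := by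
    by_contra! hc
    exact hβ (one_form_ext fun v => by simpa using hc v)
  have key : ∀ v z : V, β ![u] * w ![v, z] - β ![v] * w ![u, z] + β ![z] * w ![u, v] = 0 := by
    intro v z
    rw [← one_form_wedge_two_form_apply (Nat.add_comm 1 2), h]
    rfl
  have e1 : ∀ x : V, Function.update ![(0 : V)] 0 x = ![x] := fun x => by
    ext i; fin_cases i; simp
  have e2 : ∀ x : V, Function.update ![u, 0] 1 x = ![u, x] := fun x => by
    ext i; fin_cases i <;> simp
  let b : V →ₗ[ℝ] ℝ :=
    { toFun := fun v => β ![v]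
      map_add' := fun x y => by
        have := β.toAlternatingMap.map_update_add ![0] 0 x y
        rwa [e1, e1, e1] at this
      map_smul' := fun c x => by
        have := β.toAlternatingMap.map_update_smul ![0] 0 c x
        rwa [e1, e1] at this }
  let c : V →ₗ[ℝ] ℝ :=
    { toFun := fun v => w ![u, v]
      map_add' := fun x y => by
        have := w.toAlternatingMap.map_update_add ![u, 0] 1 x y
        rwa [e2, e2, e2] at this
      map_smul' := fun c x => by
        have := w.toAlternatingMap.map_update_smul ![u, 0] 1 c x
        rwa [e2, e2] at this }
  have : FiniteDimensional ℝ V := Module.finite_of_finrank_pos (by omega)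
  -- Two linear conditions in dimension at least `3` leave some `v ≠ 0` with `β v = 0` and `w(u, v)
  -- = 0`. For it `key` reduces to `β u * w(v, z) = 0` for all `z`, against nondegeneracy.
  have hker : LinearMap.ker (b.prod c) ≠ ⊥ := by
    intro hk
    have := LinearMap.finrank_le_finrank_of_injective (LinearMap.ker_eq_bot.1 hk)
    simp at this
    omega
  obtain ⟨v, hv, hv0⟩ := Submodule.exists_mem_ne_zero_of_ne_bot hker
  have hv' := LinearMap.mem_ker.1 hv
  have hb : β ![v] = 0 := congrArg Prod.fst hv'
  have hc : w ![u, v] = 0 := congrArg Prod.snd hv'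
  refine hv0 (hw v fun z => ?_)
  have := key v z
  rw [hb, hc] at this
  simpa [hu] using this

theorem eq_zero_of_finrank_lt [FiniteDimensional ℝ V] {q : ℕ} (hq : Module.finrank ℝ V < q)
    (α : V [⋀^Fin q]→L[ℝ] ℝ) : α = 0 := by
  ext v
  refine α.toAlternatingMap.map_linearDependent v fun hv => ?_
  have := hv.fintype_card_le_finrank
  simp at this
  omega

end WedgeAlgebra

/-! ### Exterior calculus and a uniqueness result on a normed space. -/

section Flat

variable {E : Type*} [NormedAddCommGroup E] [NormedSpace ℝ E]

/-- `extDeriv` is the alternatization of `fderiv`. Writing the wedge with a `1`-form as the same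
alternatization makes its differentiability and the Leibniz rule formal. -/
theorem one_form_wedge_eq_alternatizeUncurryFin {q : ℕ} (h : 1 + q = q + 1)
    (t : E [⋀^Fin 1]→L[ℝ] ℝ) (α : E [⋀^Fin q]→L[ℝ] ℝ) :
    wedge h t α = ContinuousAlternatingMap.alternatizeUncurryFinCLM ℝ E ℝ
      (ContinuousLinearMap.smulRightL ℝ E (E [⋀^Fin q]→L[ℝ] ℝ)
        ((ContinuousAlternatingMap.ofSubsingletonLIE (𝕜 := ℝ) (E := E) (F := ℝ)
          (0 : Fin 1)).symm t) α) := by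
  obtain ⟨s, rfl⟩ := (ContinuousAlternatingMap.ofSubsingletonLIE (𝕜 := ℝ) (E := E) (F := ℝ)
    (0 : Fin 1)).surjective t
  ext v
  rw [one_form_wedge_apply, ContinuousAlternatingMap.alternatizeUncurryFinCLM_apply,
    ContinuousAlternatingMap.alternatizeUncurryFin_apply]
  refine Finset.sum_congr rfl fun i _ => ?_
  simp

theorem DifferentiableAt.one_form_wedge {q : ℕ} (h : 1 + q = q + 1)
    {t : E → E [⋀^Fin 1]→L[ℝ] ℝ} {α : E → E [⋀^Fin q]→L[ℝ] ℝ} {x : E}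
    (ht : DifferentiableAt ℝ t x) (hα : DifferentiableAt ℝ α x) :
    DifferentiableAt ℝ (fun y => wedge h (t y) (α y)) x := by
  simp only [one_form_wedge_eq_alternatizeUncurryFin]
  fun_prop

/-- The Leibniz rule for the product of a function and a form. -/
theorem extDeriv_fun_smul_form {q : ℕ} {f : E → ℝ} {α : E → E [⋀^Fin q]→L[ℝ] ℝ} {x : E}
    (hf : DifferentiableAt ℝ f x) (hα : DifferentiableAt ℝ α x) :
    extDeriv (fun y => f y • α y) x = f x • extDeriv α x +
      wedge (Nat.add_comm 1 q) (.ofSubsingleton ℝ E ℝ (0 : Fin 1) (fderiv ℝ f x)) (α x) := by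
  rw [extDeriv, fderiv_fun_smul hf hα, ContinuousAlternatingMap.alternatizeUncurryFin_add,
    ContinuousAlternatingMap.alternatizeUncurryFin_smul, one_form_wedge_eq_alternatizeUncurryFin]
  rfl

/-- The Leibniz rule for `t ∧ α`, where `t` is a closed `1`-form and `α` a `1`-form. -/
theorem extDeriv_one_form_wedge_one_form {t α : E → E [⋀^Fin 1]→L[ℝ] ℝ} {x : E}
    (ht : DifferentiableAt ℝ t x) (hα : DifferentiableAt ℝ α x) (hdt : extDeriv t x = 0) :
    extDeriv (fun y => wedge (Nat.add_comm 1 1) (t y) (α y)) x =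
      -wedge (Nat.add_comm 1 2) (t x) (extDeriv α x) := by
  have hE : ∀ (β : E → E [⋀^Fin 1]→L[ℝ] ℝ), DifferentiableAt ℝ β x → ∀ u v : E,
      extDeriv β x ![u, v] = fderiv ℝ (fun y => β y ![v]) x u - fderiv ℝ (fun y => β y ![u]) x v := by
    intro β hβ u v
    rw [extDeriv_apply hβ, Fin.sum_univ_two]
    have h0 : (0 : Fin 2).removeNth ![u, v] = ![v] := by ext i; fin_cases i; rfl
    have h1 : (1 : Fin 2).removeNth ![u, v] = ![u] := by ext i; fin_cases i; rfl
    rw [h0, h1]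
    simp [sub_eq_add_neg]
  ext v
  have hv : v = ![v 0, v 1, v 2] := by
    ext i; fin_cases i <;> rfl
  rw [hv]
  generalize v 0 = a, v 1 = b, v 2 = c
  rw [extDeriv_apply (DifferentiableAt.one_form_wedge _ ht hα), Fin.sum_univ_three,
    ContinuousAlternatingMap.neg_apply, one_form_wedge_two_form_apply]
  have h0 : (0 : Fin 3).removeNth ![a, b, c] = ![b, c] := by
    ext i; fin_cases i <;> rfl
  have h1 : (1 : Fin 3).removeNth ![a, b, c] = ![a, c] := by
    ext i; fin_cases i <;> rfl
  have h2 : (2 : Fin 3).removeNth ![a, b, c] = ![a, b] := by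
    ext i; fin_cases i <;> rfl
  rw [h0, h1, h2]
  have hd : ∀ (β : E → E [⋀^Fin 1]→L[ℝ] ℝ), DifferentiableAt ℝ β x → ∀ u,
      DifferentiableAt ℝ (fun y => β y ![u]) x := fun β hβ u =>
    (ContinuousAlternatingMap.apply ℝ E ℝ ![u]).differentiableAt.comp x hβ
  have hL : ∀ u v z : E, fderiv ℝ (fun y => wedge (Nat.add_comm 1 1) (t y) (α y) ![u, v]) x z =
      t x ![u] * fderiv ℝ (fun y => α y ![v]) x z + fderiv ℝ (fun y => t y ![u]) x z * α x ![v]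
      - (t x ![v] * fderiv ℝ (fun y => α y ![u]) x z
        + fderiv ℝ (fun y => t y ![v]) x z * α x ![u]) := by
    intro u v z
    have e : (fun y => wedge (Nat.add_comm 1 1) (t y) (α y) ![u, v]) =
        fun y => t y ![u] * α y ![v] - t y ![v] * α y ![u] :=
      funext fun y => one_form_wedge_one_form_apply _ _ _ u v
    have ht' := hd t ht
    have hα' := hd α hα
    rw [e, fderiv_fun_sub ((ht' u).fun_mul (hα' v)) ((ht' v).fun_mul (hα' u)),
      fderiv_fun_mul (ht' u) (hα' v), fderiv_fun_mul (ht' v) (hα' u)]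
    simp
    ring
  -- Closedness of `t` as symmetry of its partial derivatives: this removes the term `dt ∧ α` of the
  -- Leibniz rule.
  have hT : ∀ u v : E, fderiv ℝ (fun y => t y ![v]) x u = fderiv ℝ (fun y => t y ![u]) x v := by
    intro u v
    have := hE t ht u v
    rw [hdt] at this
    exact (sub_eq_zero.1 this.symm)
  rw [hL, hL, hL, hE α hα, hE α hα, hE α hα]
  simp [hT b a, hT c a, hT c b]
  ring

theorem ContDiffOn.extDeriv {q : ℕ} {α : E → E [⋀^Fin q]→L[ℝ] ℝ} {s : Set E} (hs : IsOpen s)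
    (hα : ContDiffOn ℝ (⊤ : ℕ∞) α s) : ContDiffOn ℝ (⊤ : ℕ∞) (extDeriv α) s :=
  (ContinuousAlternatingMap.alternatizeUncurryFinCLM ℝ E ℝ).contDiff.comp_contDiffOn
    (hα.fderiv_of_isOpen hs (by simp))

/-- A solution of `df = -f τ` on an open set vanishes near its zeros. -/
theorem eventually_eq_zero_of_extDeriv {τ : E → E [⋀^Fin 1]→L[ℝ] ℝ} {f : E → ℝ} {s : Set E}
    (hs : IsOpen s) (hτ : ContinuousOn τ s) (hf : DifferentiableOn ℝ f s)
    (hd : ∀ y ∈ s, ∀ v, fderiv ℝ f y v = -(f y * τ y ![v])) {x : E} (hx : x ∈ s)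
    (hfx : f x = 0) : ∀ᶠ y in nhds x, f y = 0 := by
  obtain ⟨r, hr, hball⟩ := Metric.isOpen_iff.1 hs x hx
  filter_upwards [Metric.ball_mem_nhds x hr] with z hz
  -- Along the segment from `x` to `z` the equation gives `|(f ∘ γ)'| ≤ K |f ∘ γ|`, with `K` a bound
  -- for `τ` there. Grönwall with initial value `0` then gives `f z = 0`.
  let γ : ℝ → E := fun s => x + s • (z - x)
  have hγ : ∀ a ∈ Set.Icc (0 : ℝ) 1, γ a ∈ s := fun a ha => by
    refine hball ((convex_ball x r).add_smul_sub_mem (Metric.mem_ball_self hr) hz ha)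
  have hγc : Continuous γ := by fun_prop
  have hγd : ∀ a, HasDerivAt γ (z - x) a := fun a => by
    have := ((hasDerivAt_id a).smul_const (z - x)).const_add x
    rwa [one_smul] at this
  have hg : ∀ a ∈ Set.Icc (0 : ℝ) 1,
      HasDerivAt (f ∘ γ) (-(f (γ a) * τ (γ a) ![z - x])) a := fun a ha => by
    rw [← hd _ (hγ a ha)]
    exact ((hf.differentiableAt (hs.mem_nhds (hγ a ha))).hasFDerivAt.comp_hasDerivAt a (hγd a))
  have hτc : ContinuousOn (fun a => τ (γ a) ![z - x]) (Set.Icc (0 : ℝ) 1) :=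
    (ContinuousAlternatingMap.apply ℝ E ℝ ![z - x]).continuous.comp_continuousOn
      (hτ.comp hγc.continuousOn hγ)
  obtain ⟨K, hK⟩ := isCompact_Icc.exists_bound_of_continuousOn hτc
  have := norm_le_gronwallBound_of_norm_deriv_right_le (f := f ∘ γ)
    (f' := fun a => -(f (γ a) * τ (γ a) ![z - x])) (δ := 0) (K := K) (ε := 0) (a := 0) (b := 1)
    (fun a ha => (hg a ha).continuousAt.continuousWithinAt)
    (fun a ha => (hg a ⟨ha.1, ha.2.le⟩).hasDerivWithinAt) (by simp [γ, hfx])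
    (fun a ha => by
      rw [norm_neg, norm_mul, add_zero, mul_comm]
      exact mul_le_mul_of_nonneg_right (hK a ⟨ha.1, ha.2.le⟩) (norm_nonneg _)) 1 (by simp)
  simpa [gronwallBound_ε0_δ0, γ] using this

end Flat

/-! ### Forms, functions and the exterior derivative in charts. -/

section Charts

variable {n : ℕ} {M : Type*} [TopologicalSpace M]
  [ChartedSpace (EuclideanSpace ℝ (Fin (2 * n))) M]

/-- Replacing the base point of a form along an equality. -/
theorem Form.compContinuousLinearMap_congr {q : ℕ} (α : Form n M q) {x x' : M} (h : x = x')
    (A A' : Model n →L[ℝ] Model n) (hA : A = A') :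
    (α x : Model n [⋀^Fin q]→L[ℝ] ℝ).compContinuousLinearMap A =
      (α x' : Model n [⋀^Fin q]→L[ℝ] ℝ).compContinuousLinearMap A' := by
  subst h hA
  rfl

theorem inChart_ofFun (f : M → ℝ) (x₀ : M) (y : Model n) :
    (ofFun f : Form n M 0).inChart x₀ y = ContinuousAlternatingMap.constOfIsEmpty ℝ (Model n)
      (Fin 0) (f ((extChartAt 𝓘(ℝ, Model n) x₀).symm y)) := by
  ext v
  rfl

theorem differentiableAt_inChart_of_mem {q : ℕ} {α : Form n M q} (hα : α ∈ smoothForms n M q)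
    (x₀ : M) {y : Model n} (hy : y ∈ (extChartAt 𝓘(ℝ, Model n) x₀).target) :
    DifferentiableAt ℝ (α.inChart x₀) y :=
  ((hα x₀).contDiffAt ((isOpen_extChartAt_target x₀).mem_nhds hy)).differentiableAt (by simp)

theorem inChart_wedge {p q m : ℕ} (h : p + q = m) (α : Form n M p) (β : Form n M q) (x₀ : M)
    (y : Model n) : Form.inChart (fun x => wedge h (α x) (β x)) x₀ y =
      wedge h (α.inChart x₀ y) (β.inChart x₀ y) :=
  wedge_compContinuousLinearMap _ _ _ _

variable [IsManifold 𝓘(ℝ, EuclideanSpace ℝ (Fin (2 * n))) (⊤ : ℕ∞) M]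

variable (n) in
theorem mdifferentiableAt_extChartAt_symm' {x₀ : M} {y : Model n}
    (hy : y ∈ (extChartAt 𝓘(ℝ, Model n) x₀).target) :
    MDifferentiableAt 𝓘(ℝ, Model n) 𝓘(ℝ, Model n) (extChartAt 𝓘(ℝ, Model n) x₀).symm y :=
  ((contMDiffOn_extChartAt_symm (n := ((⊤ : ℕ∞) : WithTop ℕ∞)) x₀).contMDiffAt
    ((isOpen_extChartAt_target x₀).mem_nhds hy)).mdifferentiableAt (by simp)

variable (n) in
theorem mdifferentiableAt_extChartAt' {x₀ x : M}
    (hx : x ∈ (extChartAt 𝓘(ℝ, Model n) x₀).source) :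
    MDifferentiableAt 𝓘(ℝ, Model n) 𝓘(ℝ, Model n) (extChartAt 𝓘(ℝ, Model n) x₀) x :=
  ((contMDiffOn_extChartAt (I := 𝓘(ℝ, Model n)) (n := ((⊤ : ℕ∞) : WithTop ℕ∞))
    (x := x₀)).contMDiffAt (by
      simpa using (chartAt (Model n) x₀).open_source.mem_nhds (by simpa using hx))).mdifferentiableAt (by simp)

variable (n) in
theorem mfderiv_extChartAt_symm_comp (x : M) :
    (mfderiv 𝓘(ℝ, Model n) 𝓘(ℝ, Model n) (extChartAt 𝓘(ℝ, Model n) x).symm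
      (extChartAt 𝓘(ℝ, Model n) x x)).comp
        (mfderiv 𝓘(ℝ, Model n) 𝓘(ℝ, Model n) (extChartAt 𝓘(ℝ, Model n) x) x) =
      ContinuousLinearMap.id ℝ (Model n) := by
  have h := mfderiv_comp (I := 𝓘(ℝ, Model n)) (I' := 𝓘(ℝ, Model n)) (I'' := 𝓘(ℝ, Model n)) x
    (mdifferentiableAt_extChartAt_symm' n (mem_extChartAt_target (I := 𝓘(ℝ, Model n)) x))
    (mdifferentiableAt_extChartAt' n (mem_extChartAt_source (I := 𝓘(ℝ, Model n)) x))
  have h2 : ((extChartAt 𝓘(ℝ, Model n) x).symm ∘ (extChartAt 𝓘(ℝ, Model n) x)) =ᶠ[nhds x] id := by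
    filter_upwards [extChartAt_source_mem_nhds (I := 𝓘(ℝ, Model n)) x] with z hz
    exact (extChartAt 𝓘(ℝ, Model n) x).left_inv hz
  rw [h2.mfderiv_eq, mfderiv_id] at h
  exact h.symm

/-- A form is recovered at a point from its expression in the chart there. -/
theorem Form.apply_eq_inChart {q : ℕ} (α : Form n M q) (x : M) :
    α x = (α.inChart x (extChartAt 𝓘(ℝ, Model n) x x)).compContinuousLinearMap
      (mfderiv 𝓘(ℝ, Model n) 𝓘(ℝ, Model n) (extChartAt 𝓘(ℝ, Model n) x) x) := by
  have := α.compContinuousLinearMap_congr (extChartAt_to_inv (I := 𝓘(ℝ, Model n)) x) _ _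
    (mfderiv_extChartAt_symm_comp n x)
  exact this.symm

theorem Form.ext_inChart {q : ℕ} {α β : Form n M q}
    (h : ∀ x, α.inChart x (extChartAt 𝓘(ℝ, Model n) x x) =
      β.inChart x (extChartAt 𝓘(ℝ, Model n) x x)) : α = β := by
  funext x
  rw [α.apply_eq_inChart, β.apply_eq_inChart, h]

/-- The exterior derivative may be computed in any chart. -/
theorem inChart_extD {q : ℕ} {α : Form n M q} (hα : α ∈ smoothForms n M q) (x₀ : M) {y : Model n}
    (hy : y ∈ (extChartAt 𝓘(ℝ, Model n) x₀).target) :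
    (extD α).inChart x₀ y = extDeriv (α.inChart x₀) y := by
  set p : M := (extChartAt 𝓘(ℝ, Model n) x₀).symm y with hp
  -- `extD α` at `p` is computed in the preferred chart at `p`; `τ` is the transition map to it from
  -- the chart at `x₀`. Independence of the chart is the naturality of `extDeriv` under pullback by
  -- `τ`.
  let τ : Model n → Model n := extChartAt 𝓘(ℝ, Model n) p ∘ (extChartAt 𝓘(ℝ, Model n) x₀).symm
  have hτd : ∀ᶠ z in nhds y, z ∈ (extChartAt 𝓘(ℝ, Model n) x₀).target ∧
      (extChartAt 𝓘(ℝ, Model n) x₀).symm z ∈ (extChartAt 𝓘(ℝ, Model n) p).source := by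
    refine Filter.Eventually.and ((isOpen_extChartAt_target x₀).mem_nhds hy) ?_
    exact (mdifferentiableAt_extChartAt_symm' n hy).continuousAt
      (extChartAt_source_mem_nhds (I := 𝓘(ℝ, Model n)) p)
  have hchain : ∀ z, z ∈ (extChartAt 𝓘(ℝ, Model n) x₀).target ∧
      (extChartAt 𝓘(ℝ, Model n) x₀).symm z ∈ (extChartAt 𝓘(ℝ, Model n) p).source →
      fderiv ℝ τ z = (mfderiv 𝓘(ℝ, Model n) 𝓘(ℝ, Model n) (extChartAt 𝓘(ℝ, Model n) p)
        ((extChartAt 𝓘(ℝ, Model n) x₀).symm z)).comp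
        (mfderiv 𝓘(ℝ, Model n) 𝓘(ℝ, Model n) (extChartAt 𝓘(ℝ, Model n) x₀).symm z) := by
    intro z hz
    rw [← mfderiv_eq_fderiv]
    exact mfderiv_comp (I' := 𝓘(ℝ, Model n)) z (mdifferentiableAt_extChartAt' n hz.2)
      (mdifferentiableAt_extChartAt_symm' n hz.1)
  have hτs : ContDiffAt ℝ (⊤ : ℕ∞) τ y := by
    rw [← contMDiffAt_iff_contDiffAt]
    refine ContMDiffAt.comp (I' := 𝓘(ℝ, Model n)) y
      (contMDiffAt_extChartAt (I := 𝓘(ℝ, Model n)) (x := p)) ?_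
    exact (contMDiffOn_extChartAt_symm (n := ((⊤ : ℕ∞) : WithTop ℕ∞)) x₀).contMDiffAt
      ((isOpen_extChartAt_target x₀).mem_nhds hy)
  have hloc : α.inChart x₀ =ᶠ[nhds y]
      fun z => (α.inChart p (τ z)).compContinuousLinearMap (fderiv ℝ τ z) := by
    -- The chain rule at `z` needs the identity of maps near `z`, hence the condition on a whole
    -- neighbourhood.
    filter_upwards [hτd.eventually_nhds] with z hz
    have hz0 := hz.self_of_nhds
    have e1 : (extChartAt 𝓘(ℝ, Model n) p).symm (τ z) = (extChartAt 𝓘(ℝ, Model n) x₀).symm z :=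
      (extChartAt 𝓘(ℝ, Model n) p).left_inv hz0.2
    have e2 : (extChartAt 𝓘(ℝ, Model n) p).symm ∘ τ =ᶠ[nhds z]
        (extChartAt 𝓘(ℝ, Model n) x₀).symm := by
      filter_upwards [hz] with w hw
      exact (extChartAt 𝓘(ℝ, Model n) p).left_inv hw.2
    have hτz : MDifferentiableAt 𝓘(ℝ, Model n) 𝓘(ℝ, Model n) τ z :=
      MDifferentiableAt.comp (I' := 𝓘(ℝ, Model n)) z (mdifferentiableAt_extChartAt' n hz0.2)
        (mdifferentiableAt_extChartAt_symm' n hz0.1)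
    have e3 := mfderiv_comp (I := 𝓘(ℝ, Model n)) (I' := 𝓘(ℝ, Model n)) (I'' := 𝓘(ℝ, Model n)) z
      (mdifferentiableAt_extChartAt_symm' n
        ((extChartAt 𝓘(ℝ, Model n) p).map_source hz0.2)) hτz
    rw [e2.mfderiv_eq, mfderiv_eq_fderiv] at e3
    exact (α.compContinuousLinearMap_congr e1 _ _ e3.symm).symm
  have hτy : τ y = extChartAt 𝓘(ℝ, Model n) p p := rfl
  rw [hloc.extDeriv_eq, extDeriv_pullback (r := ((⊤ : ℕ∞) : WithTop ℕ∞))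
    (by rw [hτy]; exact differentiableAt_inChart hα p) hτs
    (by rw [minSmoothness_of_isRCLikeNormedField]; exact WithTop.coe_le_coe.2 le_top),
    hchain y hτd.self_of_nhds]
  rfl

theorem extD_mem_smoothForms {q : ℕ} {α : Form n M q} (hα : α ∈ smoothForms n M q) :
    extD α ∈ smoothForms n M (q + 1) := fun x₀ =>
  (ContDiffOn.extDeriv (isOpen_extChartAt_target x₀) (hα x₀)).congr fun _ hy =>
    inChart_extD hα x₀ hy

theorem inChart_twistedD {q : ℕ} {η : Form n M 1} {α : Form n M q} (hα : α ∈ smoothForms n M q)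
    (x₀ : M) {y : Model n} (hy : y ∈ (extChartAt 𝓘(ℝ, Model n) x₀).target) :
    (twistedD η α).inChart x₀ y = extDeriv (α.inChart x₀) y +
      wedge (Nat.add_comm 1 q) (η.inChart x₀ y) (α.inChart x₀ y) := by
  rw [← inChart_extD hα x₀ hy]
  exact congrArg ((extD α).inChart x₀ y + ·) (inChart_wedge (Nat.add_comm 1 q) η α x₀ y)

/-- Links `ContMDiff` for functions with the chartwise condition that defines `smoothForms`. -/
theorem contMDiff_iff_chart {f : M → ℝ} :
    ContMDiff 𝓘(ℝ, Model n) 𝓘(ℝ, ℝ) (⊤ : ℕ∞) f ↔ ∀ x₀ : M, ContDiffOn ℝ (⊤ : ℕ∞)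
      (f ∘ (extChartAt 𝓘(ℝ, Model n) x₀).symm) (extChartAt 𝓘(ℝ, Model n) x₀).target := by
  constructor
  · intro hf x₀
    rw [← contMDiffOn_iff_contDiffOn]
    exact hf.comp_contMDiffOn (contMDiffOn_extChartAt_symm x₀)
  · intro h x
    have h1 : ContMDiffAt 𝓘(ℝ, Model n) 𝓘(ℝ, ℝ) (⊤ : ℕ∞)
        (f ∘ (extChartAt 𝓘(ℝ, Model n) x).symm) (extChartAt 𝓘(ℝ, Model n) x x) :=
      contMDiffAt_iff_contDiffAt.2 ((h x).contDiffAt (extChartAt_target_mem_nhds x))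
    refine (h1.comp x contMDiffAt_extChartAt).congr_of_eventuallyEq ?_
    filter_upwards [extChartAt_source_mem_nhds (I := 𝓘(ℝ, Model n)) x] with z hz
    exact congrArg f ((extChartAt 𝓘(ℝ, Model n) x).left_inv hz).symm

theorem mulFun_mem_smoothForms {q : ℕ} {f : M → ℝ}
    (hf : ContMDiff 𝓘(ℝ, Model n) 𝓘(ℝ, ℝ) (⊤ : ℕ∞) f) {α : Form n M q}
    (hα : α ∈ smoothForms n M q) : mulFun f α ∈ smoothForms n M q := fun x₀ =>
  (contMDiff_iff_chart.1 hf x₀).smul (hα x₀)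

theorem ofFun_mem_smoothForms {f : M → ℝ} (hf : ContMDiff 𝓘(ℝ, Model n) 𝓘(ℝ, ℝ) (⊤ : ℕ∞) f) :
    (ofFun f : Form n M 0) ∈ smoothForms n M 0 := fun x₀ =>
  ((ContinuousAlternatingMap.constOfIsEmptyLIE ℝ (Model n) ℝ (Fin 0)).contDiff.comp_contDiffOn
    (contMDiff_iff_chart.1 hf x₀)).congr fun y _ => inChart_ofFun f x₀ y

theorem exists_eq_ofFun {α : Form n M 0} (hα : α ∈ smoothForms n M 0) :
    ∃ f : M → ℝ, ContMDiff 𝓘(ℝ, Model n) 𝓘(ℝ, ℝ) (⊤ : ℕ∞) f ∧ α = ofFun f := by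
  have h : α = ofFun fun x => α x ![] := by
    funext x
    ext v
    exact congrArg (α x) (Subsingleton.elim _ _)
  refine ⟨fun x => α x ![], contMDiff_iff_chart.2 fun x₀ => ?_, h⟩
  refine ((ContinuousAlternatingMap.apply ℝ (Model n) ℝ ![]).contDiff.comp_contDiffOn
    (hα x₀)).congr fun y _ => ?_
  exact congrArg (α _) (Subsingleton.elim _ _)

theorem inChart_extD_ofFun {f : M → ℝ} (hf : ContMDiff 𝓘(ℝ, Model n) 𝓘(ℝ, ℝ) (⊤ : ℕ∞) f)
    (x₀ : M) {y : Model n} (hy : y ∈ (extChartAt 𝓘(ℝ, Model n) x₀).target) :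
    (extD (ofFun f : Form n M 0)).inChart x₀ y = .ofSubsingleton ℝ (Model n) ℝ (0 : Fin 1)
      (fderiv ℝ (f ∘ (extChartAt 𝓘(ℝ, Model n) x₀).symm) y) := by
  rw [inChart_extD (ofFun_mem_smoothForms hf) x₀ hy, ← extDeriv_constOfIsEmpty]
  congr 1

theorem differentiableAt_comp_symm {f : M → ℝ}
    (hf : ContMDiff 𝓘(ℝ, Model n) 𝓘(ℝ, ℝ) (⊤ : ℕ∞) f)
    (x₀ : M) {y : Model n} (hy : y ∈ (extChartAt 𝓘(ℝ, Model n) x₀).target) :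
    DifferentiableAt ℝ (f ∘ (extChartAt 𝓘(ℝ, Model n) x₀).symm) y :=
  ((contMDiff_iff_chart.1 hf x₀).contDiffAt
    ((isOpen_extChartAt_target x₀).mem_nhds hy)).differentiableAt (by simp)

/-- The chain rule for a function of a function. -/
theorem extD_ofFun_comp {f : M → ℝ} (hf : ContMDiff 𝓘(ℝ, Model n) 𝓘(ℝ, ℝ) (⊤ : ℕ∞) f)
    {g : ℝ → ℝ} {g' : M → ℝ} (hgf : ContMDiff 𝓘(ℝ, Model n) 𝓘(ℝ, ℝ) (⊤ : ℕ∞) (g ∘ f))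
    (hg : ∀ x, HasDerivAt g (g' x) (f x)) :
    extD (ofFun (g ∘ f) : Form n M 0) = mulFun g' (extD (ofFun f)) := by
  refine Form.ext_inChart fun x => ?_
  have hy := mem_extChartAt_target (I := 𝓘(ℝ, Model n)) x
  have h1 : (mulFun g' (extD (ofFun f)) : Form n M 1).inChart x (extChartAt 𝓘(ℝ, Model n) x x) =
      g' ((extChartAt 𝓘(ℝ, Model n) x).symm (extChartAt 𝓘(ℝ, Model n) x x)) •
        (extD (ofFun f) : Form n M 1).inChart x (extChartAt 𝓘(ℝ, Model n) x x) := rfl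
  rw [h1, inChart_extD_ofFun hgf x hy, inChart_extD_ofFun hf x hy]
  have h3 := ((hg _).comp_hasFDerivAt (extChartAt 𝓘(ℝ, Model n) x x)
    (differentiableAt_comp_symm hf x hy).hasFDerivAt).fderiv
  rw [Function.comp_assoc, h3]
  rfl

/-- The Leibniz rule for the product of a function and a form. -/
theorem twistedD_mulFun {q : ℕ} (η : Form n M 1) {f : M → ℝ}
    (hf : ContMDiff 𝓘(ℝ, Model n) 𝓘(ℝ, ℝ) (⊤ : ℕ∞) f) {α : Form n M q}
    (hα : α ∈ smoothForms n M q) :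
    twistedD η (mulFun f α) = fun x => f x • twistedD η α x +
      wedge (Nat.add_comm 1 q) (extD (ofFun f) x) (α x) := by
  refine Form.ext_inChart fun x => ?_
  have hy := mem_extChartAt_target (I := 𝓘(ℝ, Model n)) x
  have h1 : Form.inChart (fun x => f x • twistedD η α x +
      wedge (Nat.add_comm 1 q) (extD (ofFun f) x) (α x)) x (extChartAt 𝓘(ℝ, Model n) x x) =
      (f ∘ (extChartAt 𝓘(ℝ, Model n) x).symm) (extChartAt 𝓘(ℝ, Model n) x x) •
        (twistedD η α).inChart x (extChartAt 𝓘(ℝ, Model n) x x) + wedge (Nat.add_comm 1 q)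
      ((extD (ofFun f) : Form n M 1).inChart x (extChartAt 𝓘(ℝ, Model n) x x))
      (α.inChart x (extChartAt 𝓘(ℝ, Model n) x x)) :=
    congrArg ((f ∘ (extChartAt 𝓘(ℝ, Model n) x).symm) (extChartAt 𝓘(ℝ, Model n) x x) •
        (twistedD η α).inChart x (extChartAt 𝓘(ℝ, Model n) x x) + ·)
      (inChart_wedge (Nat.add_comm 1 q) (extD (ofFun f)) α x _)
  have h3 : (mulFun f α).inChart x = fun y => (f ∘ (extChartAt 𝓘(ℝ, Model n) x).symm) y •
      α.inChart x y := rfl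
  rw [h1, inChart_twistedD (mulFun_mem_smoothForms hf hα) x hy,
    inChart_twistedD hα x hy, h3, extDeriv_fun_smul_form (differentiableAt_comp_symm hf x hy)
      (differentiableAt_inChart_of_mem hα x hy), inChart_extD_ofFun hf x hy, wedge_smul]
  module

end Charts

/-! ### Linear algebra of quotients of the form cocycles modulo coboundaries. -/

section Quotients

variable {E F : Type*} [AddCommGroup E] [Module ℝ E] [AddCommGroup F] [Module ℝ F]

/-- Serves the cases where an automorphism of the space of forms matches cocycles and coboundaries:
the identity in case 1, multiplication by `e^{-h}` in case 2a. -/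
theorem exists_quotient_equiv (e : E ≃ₗ[ℝ] F) (A B : Submodule ℝ E) (A' B' : Submodule ℝ F)
    (hA : ∀ x, x ∈ A ↔ e x ∈ A') (hB : ∀ x, x ∈ B ↔ e x ∈ B') :
    ∃ Φ : (A ⧸ B.comap A.subtype) ≃ₗ[ℝ] (A' ⧸ B'.comap A'.subtype), ∀ a : A, ∃ h : e a ∈ A',
      Φ (Submodule.Quotient.mk a) = Submodule.Quotient.mk ⟨e a, h⟩ := by
  have hAA : A.map (e : E →ₗ[ℝ] F) = A' := by
    ext x
    rw [Submodule.mem_map_equiv, hA, e.apply_symm_apply]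
  refine ⟨Submodule.Quotient.equiv _ _ (e.ofSubmodules A A' hAA) ?_,
    fun a => ⟨(hA a).1 a.2, rfl⟩⟩
  ext x
  rw [Submodule.mem_map_equiv]
  change ((e.ofSubmodules A A' hAA).symm x : E) ∈ B ↔ (x : F) ∈ B'
  rw [hB]
  change e (e.symm x) ∈ B' ↔ _
  rw [e.apply_symm_apply]

/-- Serves case 2b. `hB` with `c = 0` makes the map well defined, `hB` in general makes it
injective, and `hs` makes it surjective. -/
theorem exists_quotient_prod_equiv (e : E →ₗ[ℝ] F) (A B : Submodule ℝ E) (A' B' : Submodule ℝ F)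
    (ρ : F) (hA : ∀ x ∈ A, ∀ c : ℝ, e x + c • ρ ∈ A')
    (hB : ∀ x ∈ A, ∀ c : ℝ, e x + c • ρ ∈ B' ↔ x ∈ B ∧ c = 0)
    (hs : ∀ y ∈ A', ∃ x ∈ A, ∃ c : ℝ, y = e x + c • ρ) :
    ∃ Φ : ((A ⧸ B.comap A.subtype) × ℝ) ≃ₗ[ℝ] (A' ⧸ B'.comap A'.subtype),
      ∀ (a : A) (c : ℝ), ∃ h : e a + c • ρ ∈ A',
        Φ (Submodule.Quotient.mk a, c) = Submodule.Quotient.mk ⟨e a + c • ρ, h⟩ := by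
  have hA0 : ∀ x ∈ A, e x ∈ A' := fun x hx => by simpa using hA x hx 0
  have hρ : ρ ∈ A' := by simpa using hA 0 (zero_mem _) 1
  let Ψ : (A ⧸ B.comap A.subtype) →ₗ[ℝ] (A' ⧸ B'.comap A'.subtype) :=
    Submodule.mapQ _ _ (e.restrict hA0) fun x hx => by
      have := (hB x x.2 0).2 ⟨hx, rfl⟩
      simpa using this
  let Φ : ((A ⧸ B.comap A.subtype) × ℝ) →ₗ[ℝ] (A' ⧸ B'.comap A'.subtype) :=
    Ψ.coprod (LinearMap.toSpanSingleton ℝ _ (Submodule.Quotient.mk ⟨ρ, hρ⟩))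
  have hΦ : ∀ (a : A) (c : ℝ), Φ (Submodule.Quotient.mk a, c) =
      Submodule.Quotient.mk ⟨e a + c • ρ, hA a a.2 c⟩ := fun a c => rfl
  refine ⟨LinearEquiv.ofBijective Φ ⟨?_, ?_⟩, fun a c => ⟨hA a a.2 c, hΦ a c⟩⟩
  · rw [← LinearMap.ker_eq_bot, LinearMap.ker_eq_bot']
    rintro ⟨a, c⟩ h
    obtain ⟨a, rfl⟩ := Submodule.Quotient.mk_surjective _ a
    rw [hΦ, Submodule.Quotient.mk_eq_zero] at h
    obtain ⟨h1, rfl⟩ := (hB a a.2 c).1 h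
    exact Prod.ext ((Submodule.Quotient.mk_eq_zero _).2 h1) rfl
  · intro y
    obtain ⟨y, rfl⟩ := Submodule.Quotient.mk_surjective _ y
    obtain ⟨x, hx, c, hy⟩ := hs y y.2
    refine ⟨(Submodule.Quotient.mk ⟨x, hx⟩, c), ?_⟩
    rw [hΦ]
    congr 1
    exact Subtype.ext hy.symm

end Quotients

/-! ### Conjugation by `e^h` and the equation `df = -f η`. -/

section TwistedComplex

variable {n : ℕ} {M : Type*} [TopologicalSpace M]
  [ChartedSpace (EuclideanSpace ℝ (Fin (2 * n))) M]

theorem mulFun_mulFun {q : ℕ} (f g : M → ℝ) (α : Form n M q) :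
    mulFun f (mulFun g α) = mulFun (f * g) α :=
  funext fun x => smul_smul (f x) (g x) (α x)

theorem mulFun_exp_mulFun_exp_neg {q : ℕ} (h : M → ℝ) (α : Form n M q) :
    mulFun (fun x => Real.exp (h x)) (mulFun (fun x => Real.exp (-h x)) α) = α := by
  rw [mulFun_mulFun]
  funext x
  simp [mulFun, ← Real.exp_add]

theorem mulFun_exp_neg_mulFun_exp {q : ℕ} (h : M → ℝ) (α : Form n M q) :
    mulFun (fun x => Real.exp (-h x)) (mulFun (fun x => Real.exp (h x)) α) = α := by
  rw [mulFun_mulFun]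
  funext x
  simp [mulFun, ← Real.exp_add]

/-- Multiplication by a function, as a linear map. -/
noncomputable def mulFunLinear (f : M → ℝ) (q : ℕ) : Form n M q →ₗ[ℝ] Form n M q where
  toFun := mulFun f
  map_add' α β := funext fun x => smul_add (f x) (α x) (β x)
  map_smul' c α := funext fun x => smul_comm (f x) c (α x)

/-- Multiplication by `e^{-h}`, as a linear automorphism of the space of forms. -/
noncomputable def mulExpNegEquiv (h : M → ℝ) (q : ℕ) : Form n M q ≃ₗ[ℝ] Form n M q :=
  { mulFunLinear (fun x => Real.exp (-h x)) q with
    invFun := mulFun fun x => Real.exp (h x)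
    left_inv := mulFun_exp_mulFun_exp_neg h
    right_inv := mulFun_exp_neg_mulFun_exp h }

theorem lef_ofFun (ω : Form n M 2) (f : M → ℝ) : lef ω (ofFun f) = mulFun f ω :=
  funext fun x => wedge_zero_form (p := 2) rfl (ω x) (ofFun f x)

theorem twistedD_ofFun (η : Form n M 1) (f : M → ℝ) :
    twistedD η (ofFun f) = extD (ofFun f) + mulFun f η :=
  funext fun x => congrArg (extD (ofFun f) x + ·)
    (wedge_zero_form (p := 1) rfl (η x) (ofFun f x))

theorem contMDiff_exp_comp {h : M → ℝ} (hh : ContMDiff 𝓘(ℝ, Model n) 𝓘(ℝ, ℝ) (⊤ : ℕ∞) h) :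
    ContMDiff 𝓘(ℝ, Model n) 𝓘(ℝ, ℝ) (⊤ : ℕ∞) fun x => Real.exp (h x) :=
  Real.contDiff_exp.contMDiff.comp hh

theorem ofFun_sub_smul (f g : M → ℝ) (c : ℝ) :
    (ofFun (fun x => f x - c * g x) : Form n M 0) = ofFun f + (-c) • ofFun g := by
  funext x
  ext v
  change f x - c * g x = f x + -c * g x
  ring

variable [IsManifold 𝓘(ℝ, EuclideanSpace ℝ (Fin (2 * n))) (⊤ : ℕ∞) M]

theorem extD_extD {q : ℕ} {α : Form n M q} (hα : α ∈ smoothForms n M q) : extD (extD α) = 0 := by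
  refine Form.ext_inChart fun x => ?_
  have hy := mem_extChartAt_target (I := 𝓘(ℝ, Model n)) x
  -- `extD` changes chart from point to point, so it is first expressed in one fixed chart near `x`,
  -- where `d² = 0` on the model space applies.
  have hloc : (extD α).inChart x =ᶠ[nhds (extChartAt 𝓘(ℝ, Model n) x x)]
      extDeriv (α.inChart x) := by
    filter_upwards [extChartAt_target_mem_nhds (I := 𝓘(ℝ, Model n)) x] with z hz
    exact inChart_extD hα x hz
  rw [inChart_extD (extD_mem_smoothForms hα) x hy, hloc.extDeriv_eq,
    extDeriv_extDeriv_apply ((hα x).contDiffAt (extChartAt_target_mem_nhds x))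
      (by rw [minSmoothness_of_isRCLikeNormedField]; exact WithTop.coe_le_coe.2 le_top)]
  rfl

theorem twistedD_ofFun_mem_smoothForms {η : Form n M 1} (hη : η ∈ smoothForms n M 1) {f : M → ℝ}
    (hf : ContMDiff 𝓘(ℝ, Model n) 𝓘(ℝ, ℝ) (⊤ : ℕ∞) f) :
    twistedD η (ofFun f) ∈ smoothForms n M 1 := by
  rw [twistedD_ofFun]
  exact add_mem (extD_mem_smoothForms (ofFun_mem_smoothForms hf)) (mulFun_mem_smoothForms hf hη)

/-- In `d(df) + η ∧ df + f (dη + η ∧ η) + df ∧ η` the mixed terms cancel and the others vanish.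
Degree `0` suffices: it shows that `d_k`-exact `1`-forms are closed. -/
theorem twistedD_twistedD_ofFun {η : Form n M 1} (hη : η ∈ smoothForms n M 1)
    (hdη : extD η = 0) {f : M → ℝ} (hf : ContMDiff 𝓘(ℝ, Model n) 𝓘(ℝ, ℝ) (⊤ : ℕ∞) f) :
    twistedD η (twistedD η (ofFun f)) = 0 := by
  have hd := extD_mem_smoothForms (ofFun_mem_smoothForms hf)
  rw [twistedD_ofFun, twistedD_add η hd (mulFun_mem_smoothForms hf hη), twistedD_mulFun η hf hη]
  funext x
  change (extD (extD (ofFun f)) x + wedge (Nat.add_comm 1 1) (η x) (extD (ofFun f) x)) +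
    (f x • (extD η x + wedge (Nat.add_comm 1 1) (η x) (η x)) +
      wedge (Nat.add_comm 1 1) (extD (ofFun f) x) (η x)) = 0
  rw [extD_extD (ofFun_mem_smoothForms hf), hdη, one_form_wedge_self,
    one_form_wedge_antisymm (η x)]
  simp only [Form.zero_apply, zero_add, add_zero, smul_zero]
  exact neg_add_cancel _

/-- Conjugation of the twisted differential by `e^h`. -/
theorem twistedD_mulFun_exp {q : ℕ} (η : Form n M 1) {h : M → ℝ}
    (hh : ContMDiff 𝓘(ℝ, Model n) 𝓘(ℝ, ℝ) (⊤ : ℕ∞) h) {α : Form n M q}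
    (hα : α ∈ smoothForms n M q) :
    twistedD η (mulFun (fun x => Real.exp (h x)) α) =
      mulFun (fun x => Real.exp (h x)) (twistedD (η + extD (ofFun h)) α) := by
  have he : ContMDiff 𝓘(ℝ, Model n) 𝓘(ℝ, ℝ) (⊤ : ℕ∞) (Real.exp ∘ h) :=
    Real.contDiff_exp.contMDiff.comp hh
  have := twistedD_mulFun η he hα
  rw [extD_ofFun_comp (g := Real.exp) hh he fun x => Real.hasDerivAt_exp (h x)] at this
  refine Eq.trans this ?_
  funext x
  simp only [mulFun, twistedD, Form.add_apply, add_wedge, smul_wedge, Function.comp, smul_add,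
    add_assoc]

/-- On a connected manifold a solution of `df = -f η` with a zero vanishes identically. -/
theorem eq_zero_of_extD_ofFun_eq [ConnectedSpace M] {η : Form n M 1} (hη : η ∈ smoothForms n M 1)
    {f : M → ℝ} (hf : ContMDiff 𝓘(ℝ, Model n) 𝓘(ℝ, ℝ) (⊤ : ℕ∞) f)
    (hd : extD (ofFun f) = -mulFun f η) {x₀ : M} (h0 : f x₀ = 0) (x : M) : f x = 0 := by
  -- The zero set is closed by continuity and open by `eventually_eq_zero_of_extDeriv`, so
  -- connectedness makes it everything.
  have hclosed : IsClosed {x | f x = 0} := isClosed_eq hf.continuous continuous_const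
  have hopen : IsOpen {x | f x = 0} := by
    rw [isOpen_iff_mem_nhds]
    intro z hz
    have hy := mem_extChartAt_target (I := 𝓘(ℝ, Model n)) z
    have := eventually_eq_zero_of_extDeriv (isOpen_extChartAt_target (I := 𝓘(ℝ, Model n)) z)
      (hη z).continuousOn
      (fun y hy => (differentiableAt_comp_symm hf z hy).differentiableWithinAt) (fun y hy v => by
        have h1 := inChart_extD_ofFun hf z hy
        rw [hd] at h1
        exact (congrArg (fun A : Model n [⋀^Fin 1]→L[ℝ] ℝ => A ![v]) h1).symm) hy
      (by rw [Function.comp, extChartAt_to_inv]; exact hz)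
    have h2 := (continuousAt_extChartAt (I := 𝓘(ℝ, Model n)) z).eventually this
    filter_upwards [h2, extChartAt_source_mem_nhds (I := 𝓘(ℝ, Model n)) z] with w hw hws
    rw [Function.comp, (extChartAt 𝓘(ℝ, Model n) z).left_inv hws] at hw
    exact hw
  have := IsClopen.eq_univ ⟨hclosed, hopen⟩ ⟨x₀, h0⟩
  exact (Set.eq_univ_iff_forall.1 this) x

/-- Take `g = -log |f|`, so that `dg = -df / f = η`. As `Real.log` is the logarithm of the absolute
value, the sign of `f` plays no role. -/
theorem exists_extD_ofFun_eq_of_ne_zero {η : Form n M 1} {f : M → ℝ}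
    (hf : ContMDiff 𝓘(ℝ, Model n) 𝓘(ℝ, ℝ) (⊤ : ℕ∞) f)
    (hd : extD (ofFun f) = -mulFun f η) (h0 : ∀ x, f x ≠ 0) :
    ∃ g : M → ℝ, ContMDiff 𝓘(ℝ, Model n) 𝓘(ℝ, ℝ) (⊤ : ℕ∞) g ∧ extD (ofFun g) = η := by
  have hg : ContMDiff 𝓘(ℝ, Model n) 𝓘(ℝ, ℝ) (⊤ : ℕ∞) ((fun r => -Real.log r) ∘ f) := fun x =>
    ((Real.contDiffAt_log.2 (h0 x)).neg.contMDiffAt).comp x (hf x)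
  refine ⟨_, hg, ?_⟩
  rw [extD_ofFun_comp hf hg (g' := fun x => -(f x)⁻¹) fun x => (Real.hasDerivAt_log (h0 x)).neg, hd]
  funext x
  change -(f x)⁻¹ • -(f x • η x) = η x
  rw [neg_smul_neg, smul_smul, inv_mul_cancel₀ (h0 x), one_smul]

/-- On a connected manifold the solutions of `df = f dh` are the multiples of `e^h`. -/
theorem exists_eq_mul_exp [ConnectedSpace M] {η : Form n M 1} (hη : η ∈ smoothForms n M 1)
    {f h : M → ℝ} (hf : ContMDiff 𝓘(ℝ, Model n) 𝓘(ℝ, ℝ) (⊤ : ℕ∞) f)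
    (hh : ContMDiff 𝓘(ℝ, Model n) 𝓘(ℝ, ℝ) (⊤ : ℕ∞) h)
    (hdf : extD (ofFun f) = -mulFun f η) (hdh : extD (ofFun h) = -η) :
    ∃ c : ℝ, ∀ x, f x = c * Real.exp (h x) := by
  obtain ⟨x₀⟩ := (inferInstance : Nonempty M)
  have he := contMDiff_exp_comp hh
  -- The constant makes `f` and `c e^h` agree at `x₀`; their difference solves the same linear
  -- equation and has a zero there.
  refine ⟨f x₀ * Real.exp (-h x₀), fun x => sub_eq_zero.1 ?_⟩
  refine eq_zero_of_extD_ofFun_eq (x₀ := x₀) hη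
    (f := fun x => f x - f x₀ * Real.exp (-h x₀) * Real.exp (h x))
    (hf.sub (contMDiff_const.mul he)) ?_ ?_ x
  · have h1 : extD (ofFun fun x => Real.exp (h x) : Form n M 0) = _ :=
      extD_ofFun_comp (g := Real.exp) hh he fun x => Real.hasDerivAt_exp (h x)
    rw [ofFun_sub_smul, extD_add (ofFun_mem_smoothForms hf)
      (Submodule.smul_mem _ _ (ofFun_mem_smoothForms he)), extD_smul, h1, hdf, hdh]
    funext x
    change -(f x • η x) + (-(f x₀ * Real.exp (-h x₀))) • (Real.exp (h x) • -η x) =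
      -((f x - f x₀ * Real.exp (-h x₀) * Real.exp (h x)) • η x)
    module
  · simp [mul_assoc, ← Real.exp_add]

end TwistedComplex

/-! ### Primitive cohomology in degree one. -/

section PlusCohomologyOne

variable {n : ℕ} {M : Type*} [TopologicalSpace M]
  [ChartedSpace (EuclideanSpace ℝ (Fin (2 * n))) M]

theorem form_eq_zero_of_lt {q : ℕ} (hq : 2 * n < q) (α : Form n M q) : α = 0 := by
  have key : ∀ β : Model n [⋀^Fin q]→L[ℝ] ℝ, β = 0 :=
    eq_zero_of_finrank_lt (by simpa using hq)
  exact funext fun x => key (α x)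

/-- The form `L^{n+1} α` has degree `2n + 2 > 2n`, so the condition is empty. For `1`-forms, `L^n α`
has degree `2n + 1`, with the same effect. -/
theorem primitiveForms_zero (ω : Form n M 2) : primitiveForms ω 0 = smoothForms n M 0 :=
  le_antisymm (fun _ h => h.1) fun _ h =>
    ⟨h, fun _ => form_eq_zero_of_lt (by omega) _, fun h => absurd h (by omega)⟩

theorem primitiveForms_one (hn : 1 ≤ n) (ω : Form n M 2) :
    primitiveForms ω 1 = smoothForms n M 1 :=
  le_antisymm (fun _ h => h.1) fun _ h =>
    ⟨h, fun _ => form_eq_zero_of_lt (by omega) _, fun h => absurd h (by omega)⟩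

theorem IsLCS.eq_zero_of_smul_form {ω : Form n M 2} {θ : Form n M 1}
    (hω : IsLCS ω θ) (hn : 1 ≤ n) {f : M → ℝ} (hf : mulFun f ω = 0) (x : M) : f x = 0 := by
  by_contra hfx
  have hωx : ω x = 0 := by
    have : f x • ω x = 0 := congrFun hf x
    exact (smul_eq_zero.1 this).resolve_left hfx
  have : Nontrivial (Model n) := by
    apply Module.nontrivial_of_finrank_pos (R := ℝ)
    rw [finrank_euclideanSpace_fin]
    omega
  obtain ⟨v, hv⟩ := exists_ne (0 : Model n)
  exact hv (hω.nondegenerate x v fun w => by rw [hωx]; rfl)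

variable [IsManifold 𝓘(ℝ, EuclideanSpace ℝ (Fin (2 * n))) (⊤ : ℕ∞) M]

/-- In degree `2`, `L Ω^0` consists of the multiples `f ω`. The kernel of `d_η^+` is thus described
without using that the Lefschetz decomposition exists. -/
theorem mem_plusCocycles_one (hn : 1 ≤ n) {ω : Form n M 2} {η : Form n M 1} {α : Form n M 1} :
    α ∈ plusCocycles ω η 1 ↔ α ∈ smoothForms n M 1 ∧
      ∃ f : M → ℝ, ContMDiff 𝓘(ℝ, Model n) 𝓘(ℝ, ℝ) (⊤ : ℕ∞) f ∧
        twistedD η α = mulFun f ω := by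
  change (α ∈ primitiveForms ω 1 ∧ (0 : Form n M 2) ∈ primitiveForms ω 2 ∧
    ∃ γ ∈ smoothForms n M 0, lef ω γ = twistedD η α - 0) ↔ _
  rw [primitiveForms_one hn, sub_zero]
  constructor
  · rintro ⟨hα, -, γ, hγ, h⟩
    obtain ⟨f, hf, rfl⟩ := exists_eq_ofFun hγ
    exact ⟨hα, f, hf, by rw [← h, lef_ofFun]⟩
  · rintro ⟨hα, f, hf, h⟩
    exact ⟨hα, zero_mem _, ofFun f, ofFun_mem_smoothForms hf, by rw [h, lef_ofFun]⟩

/-- In degree `1` all smooth forms are primitive and `L Ω^*` is zero, so the projection does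
nothing. -/
theorem plusCoboundaries_one (hn : 1 ≤ n) (ω : Form n M 2) {η : Form n M 1}
    (hη : η ∈ smoothForms n M 1) : plusCoboundaries ω η 1 = coboundaries η 1 := by
  ext α
  change (∃ β ∈ primitiveForms ω 0, α ∈ primitiveForms ω 1 ∧
    twistedD η β - α ∈ (⊥ : Submodule ℝ (Form n M 1))) ↔
    ∃ β ∈ smoothForms n M 0, twistedD η β = α
  rw [primitiveForms_zero, primitiveForms_one hn]
  constructor
  · rintro ⟨β, hβ, -, h⟩
    exact ⟨β, hβ, sub_eq_zero.1 h⟩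
  · rintro ⟨β, hβ, rfl⟩
    obtain ⟨f, hf, rfl⟩ := exists_eq_ofFun hβ
    exact ⟨_, hβ, twistedD_ofFun_mem_smoothForms hη hf, by rw [sub_self]; exact zero_mem _⟩

/-- The derivative `A` of the inverse chart has the right inverse `B`, hence is surjective, and
injective by dimension; pullback along it preserves nondegeneracy. -/
theorem inChart_nondegenerate {ω : Form n M 2} {θ : Form n M 1} (hω : IsLCS ω θ) (x : M)
    (v : Model n) (hv : ∀ u, ω.inChart x (extChartAt 𝓘(ℝ, Model n) x x) ![v, u] = 0) : v = 0 := by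
  let A : Model n →L[ℝ] Model n := mfderiv 𝓘(ℝ, Model n) 𝓘(ℝ, Model n)
    (extChartAt 𝓘(ℝ, Model n) x).symm (extChartAt 𝓘(ℝ, Model n) x x)
  let B : Model n →L[ℝ] Model n := mfderiv 𝓘(ℝ, Model n) 𝓘(ℝ, Model n)
    (extChartAt 𝓘(ℝ, Model n) x) x
  have hAB : ∀ u, A (B u) = u := fun u =>
    congrArg (fun C : Model n →L[ℝ] Model n => C u) (mfderiv_extChartAt_symm_comp n x)
  have hinj : Function.Injective A :=
    (LinearMap.injective_iff_surjective (f := (A : Model n →ₗ[ℝ] Model n))).2 fun u => ⟨B u, hAB u⟩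
  refine hinj (Eq.trans ?_ (map_zero A).symm)
  refine hω.nondegenerate ((extChartAt 𝓘(ℝ, Model n) x).symm (extChartAt 𝓘(ℝ, Model n) x x))
    (A v) fun w => ?_
  have h1 := hv (B w)
  have h2 : A ∘ ![v, B w] = ![A v, w] := by
    funext i
    fin_cases i
    · rfl
    · exact hAB w
  exact (congrArg (fun z => ω _ z) h2).symm.trans h1

/-- If `d_c α = f ω` then `df = -(c - 1) f θ`. -/
theorem IsLCS.extD_ofFun_of_twistedD_eq (hn : 2 ≤ n) {ω : Form n M 2} {θ : Form n M 1}
    (hω : IsLCS ω θ) (c : ℝ) {α : Form n M 1} (hα : α ∈ smoothForms n M 1) {f : M → ℝ}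
    (hf : ContMDiff 𝓘(ℝ, Model n) 𝓘(ℝ, ℝ) (⊤ : ℕ∞) f)
    (h : twistedD (c • θ) α = mulFun f ω) : extD (ofFun f) = -mulFun f ((c - 1) • θ) := by
  refine Form.ext_inChart fun x => ?_
  have hy := mem_extChartAt_target (I := 𝓘(ℝ, Model n)) x
  have htgt := extChartAt_target_mem_nhds (I := 𝓘(ℝ, Model n)) x
  rw [inChart_extD_ofFun hf x hy]
  change _ = -((f ∘ (extChartAt 𝓘(ℝ, Model n) x).symm) (extChartAt 𝓘(ℝ, Model n) x x) •
    ((c - 1) • θ.inChart x (extChartAt 𝓘(ℝ, Model n) x x)))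
  have hα' : ∀ y ∈ (extChartAt 𝓘(ℝ, Model n) x).target, extDeriv (α.inChart x) y =
      (f ∘ (extChartAt 𝓘(ℝ, Model n) x).symm) y • ω.inChart x y +
        (-c) • wedge (Nat.add_comm 1 1) (θ.inChart x y) (α.inChart x y) := by
    intro y hy
    have h1 := inChart_twistedD (η := c • θ) hα x hy
    rw [h, Form.inChart_smul, Pi.smul_apply, smul_wedge] at h1
    change (f ∘ (extChartAt 𝓘(ℝ, Model n) x).symm) y • ω.inChart x y = _ at h1
    rw [h1]
    module
  have hdω : extDeriv (ω.inChart x) (extChartAt 𝓘(ℝ, Model n) x x) =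
      -wedge (Nat.add_comm 1 2) (θ.inChart x (extChartAt 𝓘(ℝ, Model n) x x))
        (ω.inChart x (extChartAt 𝓘(ℝ, Model n) x x)) := by
    have h1 := inChart_twistedD (η := θ) hω.smooth_form x hy
    rw [hω.closed_form] at h1
    exact eq_neg_of_add_eq_zero_left h1.symm
  have hdθ : extDeriv (θ.inChart x) (extChartAt 𝓘(ℝ, Model n) x x) = 0 := by
    rw [← inChart_extD hω.smooth_lee x hy, hω.closed_lee]
    rfl
  have hFd := differentiableAt_comp_symm hf x hy
  have hωd := differentiableAt_inChart hω.smooth_form x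
  have hθd := differentiableAt_inChart hω.smooth_lee x
  have hαd := differentiableAt_inChart hα x
  have hloc : extDeriv (α.inChart x) =ᶠ[nhds (extChartAt 𝓘(ℝ, Model n) x x)] fun y =>
      (f ∘ (extChartAt 𝓘(ℝ, Model n) x).symm) y • ω.inChart x y +
        (-c) • wedge (Nat.add_comm 1 1) (θ.inChart x y) (α.inChart x y) :=
    Filter.eventually_of_mem htgt hα'
  -- Differentiating `dα = f ω - c θ ∧ α` once more gives `0 = df ∧ ω + f dω + c θ ∧ dα`.
  -- Substituting `dω = -θ ∧ ω` and `dα` again, with `θ ∧ θ ∧ α = 0`, leaves `(df + (c - 1) f θ) ∧ ω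
  -- = 0`.
  have hdd := extDeriv_extDeriv_apply ((hα x).contDiffAt htgt)
    (by rw [minSmoothness_of_isRCLikeNormedField]; exact WithTop.coe_le_coe.2 le_top)
  have hwd := DifferentiableAt.one_form_wedge (Nat.add_comm 1 1) hθd hαd
  have hsm : extDeriv (fun y => (-c) • wedge (Nat.add_comm 1 1) (θ.inChart x y) (α.inChart x y))
      (extChartAt 𝓘(ℝ, Model n) x x) = (-c) • extDeriv (fun y =>
        wedge (Nat.add_comm 1 1) (θ.inChart x y) (α.inChart x y)) _ := extDeriv_smul (-c) _
  rw [hloc.extDeriv_eq, extDeriv_fun_add (hFd.fun_smul hωd) (hwd.fun_const_smul (-c)),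
    extDeriv_fun_smul_form hFd hωd, hsm, extDeriv_one_form_wedge_one_form hθd hαd hdθ,
    hα' _ hy, wedge_add, wedge_smul, wedge_smul, one_form_wedge_one_form_wedge_self, hdω] at hdd
  refine eq_neg_of_add_eq_zero_left (eq_zero_of_wedge_nondegenerate (by simp; omega) _ _
    (inChart_nondegenerate hω x) ?_)
  rw [add_wedge, smul_wedge, smul_wedge, ← hdd]
  module

end PlusCohomologyOne

end LCS

/-! ### The theorem: assembly of the cases. -/

theorem proposition3p9 (n : ℕ) (hn : 2 ≤ n)
    (M : Type*) [TopologicalSpace M] [T2Space M] [SecondCountableTopology M] [ConnectedSpace M]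
    [ChartedSpace (EuclideanSpace ℝ (Fin (2 * n))) M]
    [IsManifold 𝓘(ℝ, EuclideanSpace ℝ (Fin (2 * n))) (⊤ : ℕ∞) M]
    (ω : LCS.Form n M 2) (θ : LCS.Form n M 1) (hω : LCS.IsLCS ω θ) (k : ℤ) :
    (hω.leeClass ((k : ℝ) - 1) ≠ 0 →
      ∃ e : LCS.PlusCohomology ω ((k : ℝ) • θ) 1 ≃ₗ[ℝ] LCS.Cohomology ((k : ℝ) • θ) 1,
        ∀ α : LCS.plusCocycles ω ((k : ℝ) • θ) 1,
          ∃ hα : (α : LCS.Form n M 1) ∈ LCS.cocycles ((k : ℝ) • θ) 1,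
            e (LCS.plusClass ω ((k : ℝ) • θ) α) =
              LCS.cohomologyClass ((k : ℝ) • θ) ⟨α, hα⟩) ∧
    (hω.leeClass ((k : ℝ) - 1) = 0 →
      (∃ h : M → ℝ, ContMDiff 𝓘(ℝ, EuclideanSpace ℝ (Fin (2 * n)))
          𝓘(ℝ, ℝ) (⊤ : ℕ∞) h ∧
        LCS.extD (LCS.ofFun h) = -(((k : ℝ) - 1) • θ)) ∧
      ∀ h : M → ℝ, ContMDiff 𝓘(ℝ, EuclideanSpace ℝ (Fin (2 * n)))
          𝓘(ℝ, ℝ) (⊤ : ℕ∞) h →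
        LCS.extD (LCS.ofFun h) = -(((k : ℝ) - 1) • θ) →
        (hω.formClass ≠ 0 →
          ∃ e : LCS.PlusCohomology ω ((k : ℝ) • θ) 1 ≃ₗ[ℝ] LCS.Cohomology θ 1,
            ∀ α : LCS.plusCocycles ω ((k : ℝ) • θ) 1,
              ∃ hα : LCS.mulFun (fun x => Real.exp (-h x)) (α : LCS.Form n M 1)
                  ∈ LCS.cocycles θ 1,
                e (LCS.plusClass ω ((k : ℝ) • θ) α) = LCS.cohomologyClass θ ⟨_, hα⟩) ∧
        (hω.formClass = 0 →
          (∃ ρ ∈ LCS.plusCocycles ω ((k : ℝ) • θ) 1,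
            LCS.twistedD ((k : ℝ) • θ) ρ = LCS.mulFun (fun x => Real.exp (h x)) ω) ∧
          ∀ ρ ∈ LCS.plusCocycles ω ((k : ℝ) • θ) 1,
            LCS.twistedD ((k : ℝ) • θ) ρ = LCS.mulFun (fun x => Real.exp (h x)) ω →
            ∃ e : (LCS.Cohomology θ 1 × ℝ) ≃ₗ[ℝ] LCS.PlusCohomology ω ((k : ℝ) • θ) 1,
              ∀ (β : LCS.cocycles θ 1) (c : ℝ),
                ∃ hβ : LCS.mulFun (fun x => Real.exp (h x)) (β : LCS.Form n M 1) + c • ρ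
                    ∈ LCS.plusCocycles ω ((k : ℝ) • θ) 1,
                  e (LCS.cohomologyClass θ β, c) =
                    LCS.plusClass ω ((k : ℝ) • θ) ⟨_, hβ⟩)) := by
  have hn1 : 1 ≤ n := by omega
  have hη : (k : ℝ) • θ ∈ LCS.smoothForms n M 1 := Submodule.smul_mem _ _ hω.smooth_lee
  have hζ : ((k : ℝ) - 1) • θ ∈ LCS.smoothForms n M 1 := Submodule.smul_mem _ _ hω.smooth_lee
  have hdη : LCS.extD ((k : ℝ) • θ) = 0 := by rw [LCS.extD_smul, hω.closed_lee, smul_zero]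
  have hcob := LCS.plusCoboundaries_one hn1 ω hη
  have hclosed : ∀ α ∈ LCS.cocycles ((k : ℝ) • θ) 1, α ∈ LCS.plusCocycles ω ((k : ℝ) • θ) 1 := by
    intro α hα
    refine (LCS.mem_plusCocycles_one hn1).2 ⟨hα.1, 0, contMDiff_const, ?_⟩
    rw [hα.2]
    funext x
    exact (zero_smul ℝ (ω x)).symm
  refine ⟨fun hne => ?_, fun h0 => ⟨?_, fun h hh hdh => ?_⟩⟩
  · have hA : ∀ α, α ∈ LCS.plusCocycles ω ((k : ℝ) • θ) 1 ↔
        α ∈ LCS.cocycles ((k : ℝ) • θ) 1 := by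
      refine fun α => ⟨fun hα => ?_, hclosed α⟩
      obtain ⟨hαs, f, hf, hfω⟩ := (LCS.mem_plusCocycles_one hn1).1 hα
      have hdf := hω.extD_ofFun_of_twistedD_eq hn _ hαs hf hfω
      -- Without a zero of `f`, `-log |f|` would be a primitive of `(k - 1) θ`.
      have hz : ∃ x, f x = 0 := by
        by_contra! hc
        obtain ⟨g, hg, hdg⟩ := LCS.exists_extD_ofFun_eq_of_ne_zero hf hdf hc
        refine hne ((Submodule.Quotient.mk_eq_zero _).2
          ⟨LCS.ofFun g, LCS.ofFun_mem_smoothForms hg, ?_⟩)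
        rw [LCS.twistedD_zero, hdg]
        rfl
      obtain ⟨x₀, hx₀⟩ := hz
      refine ⟨hαs, ?_⟩
      rw [hfω]
      funext x
      have := LCS.eq_zero_of_extD_ofFun_eq hζ hf hdf hx₀ x
      change f x • ω x = 0
      rw [this, zero_smul]
    exact LCS.exists_quotient_equiv (LinearEquiv.refl ℝ _) _ _ _ _ hA fun α => by rw [hcob]; rfl
  · obtain ⟨β, hβ, hdβ⟩ := (Submodule.Quotient.mk_eq_zero _).1 h0
    obtain ⟨f, hf, rfl⟩ := LCS.exists_eq_ofFun hβ
    rw [LCS.twistedD_zero] at hdβ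
    have hneg : (LCS.ofFun (-f) : LCS.Form n M 0) = (-1 : ℝ) • LCS.ofFun f := by
      funext x
      ext v
      exact (neg_one_mul (f x)).symm
    -- Exactness provides `df = (k - 1) θ`; the required sign is the opposite one.
    refine ⟨-f, hf.neg, ?_⟩
    rw [hneg, LCS.extD_smul, hdβ, neg_one_smul]
    rfl
  · have hsum : (k : ℝ) • θ + LCS.extD (LCS.ofFun h) = θ := by rw [hdh]; module
    have he := LCS.contMDiff_exp_comp hh
    have hen := LCS.contMDiff_exp_comp hh.neg
    have hconj : ∀ {q : ℕ} {α : LCS.Form n M q}, α ∈ LCS.smoothForms n M q →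
        LCS.twistedD ((k : ℝ) • θ) (LCS.mulFun (fun x => Real.exp (h x)) α) =
          LCS.mulFun (fun x => Real.exp (h x)) (LCS.twistedD θ α) := fun hα => by
      rw [LCS.twistedD_mulFun_exp _ hh hα, hsum]
    have hconj' : ∀ {q : ℕ} {α : LCS.Form n M q}, α ∈ LCS.smoothForms n M q →
        LCS.twistedD θ (LCS.mulFun (fun x => Real.exp (-h x)) α) =
          LCS.mulFun (fun x => Real.exp (-h x)) (LCS.twistedD ((k : ℝ) • θ) α) := fun {q α} hα => by
      have := hconj (LCS.mulFun_mem_smoothForms hen hα)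
      rw [LCS.mulFun_exp_mulFun_exp_neg] at this
      rw [this, LCS.mulFun_exp_neg_mulFun_exp]
    have hB : ∀ α : LCS.Form n M 1, α ∈ LCS.coboundaries ((k : ℝ) • θ) 1 ↔
        LCS.mulFun (fun x => Real.exp (-h x)) α ∈ LCS.coboundaries θ 1 := by
      intro α
      constructor
      · rintro ⟨β, hβ, rfl⟩
        exact ⟨_, LCS.mulFun_mem_smoothForms hen hβ, hconj' hβ⟩
      · rintro ⟨β, hβ, h1⟩
        refine ⟨_, LCS.mulFun_mem_smoothForms he hβ, ?_⟩
        rw [hconj hβ, h1, LCS.mulFun_exp_mulFun_exp_neg]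
    -- The constant `c` attached to a cocycle: it is the obstruction to being `d_k`-closed.
    have hcoef : ∀ α ∈ LCS.plusCocycles ω ((k : ℝ) • θ) 1, ∃ c : ℝ,
        LCS.twistedD ((k : ℝ) • θ) α = c • LCS.mulFun (fun x => Real.exp (h x)) ω := by
      intro α hα
      obtain ⟨hαs, f, hf, hfω⟩ := (LCS.mem_plusCocycles_one hn1).1 hα
      obtain ⟨c, hc⟩ := LCS.exists_eq_mul_exp hζ hf hh
        (hω.extD_ofFun_of_twistedD_eq hn _ hαs hf hfω) hdh
      refine ⟨c, ?_⟩
      rw [hfω]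
      funext x
      change f x • ω x = c • (Real.exp (h x) • ω x)
      rw [hc, smul_smul]
    refine ⟨fun hne => ?_, fun hz => ⟨?_, fun ρ hρ hdρ => ?_⟩⟩
    · have hA : ∀ α, α ∈ LCS.plusCocycles ω ((k : ℝ) • θ) 1 ↔
          LCS.mulFun (fun x => Real.exp (-h x)) α ∈ LCS.cocycles θ 1 := by
        intro α
        constructor
        · intro hα
          obtain ⟨c, hc⟩ := hcoef α hα
          have hs := LCS.mulFun_mem_smoothForms hen hα.1.1
          have h1 := hconj' hα.1.1
          rw [hc] at h1
          have h2 : LCS.twistedD θ (LCS.mulFun (fun x => Real.exp (-h x)) α) = c • ω := by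
            rw [h1]
            exact ((LCS.mulFunLinear _ 2).map_smul c _).trans
              (congrArg _ (LCS.mulFun_exp_neg_mulFun_exp h ω))
          -- If `c ≠ 0`, then `ω = d_θ (c⁻¹ e^{-h} α)` is exact, against the hypothesis.
          by_cases hc0 : c = 0
          · exact ⟨hs, by rw [h2, hc0, zero_smul]⟩
          · refine (hne ((Submodule.Quotient.mk_eq_zero _).2
              ⟨c⁻¹ • LCS.mulFun (fun x => Real.exp (-h x)) α, Submodule.smul_mem _ _ hs, ?_⟩)).elim
            rw [LCS.twistedD_smul, h2, smul_smul, inv_mul_cancel₀ hc0, one_smul]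
            rfl
        · rintro ⟨hs, hd⟩
          refine hclosed α ?_
          rw [← LCS.mulFun_exp_mulFun_exp_neg h α]
          refine ⟨LCS.mulFun_mem_smoothForms he hs, ?_⟩
          rw [hconj hs, hd]
          exact (LCS.mulFunLinear _ 2).map_zero
      exact LCS.exists_quotient_equiv (LCS.mulExpNegEquiv h 1) _ _ _ _ hA fun α => by
        rw [hcob]; exact hB α
    · obtain ⟨β, hβ, hdβ⟩ := (Submodule.Quotient.mk_eq_zero _).1 hz
      have h1 : LCS.twistedD ((k : ℝ) • θ) (LCS.mulFun (fun x => Real.exp (h x)) β) =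
          LCS.mulFun (fun x => Real.exp (h x)) ω := by
        rw [hconj hβ, hdβ]
        rfl
      exact ⟨_, (LCS.mem_plusCocycles_one hn1).2
        ⟨LCS.mulFun_mem_smoothForms he hβ, _, he, h1⟩, h1⟩
    · have hdsum : ∀ β ∈ LCS.cocycles θ 1, ∀ c : ℝ, LCS.twistedD ((k : ℝ) • θ)
          (LCS.mulFun (fun x => Real.exp (h x)) β + c • ρ) =
            c • LCS.mulFun (fun x => Real.exp (h x)) ω := by
        intro β hβ c
        rw [LCS.twistedD_add _ (LCS.mulFun_mem_smoothForms he hβ.1)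
          (Submodule.smul_mem _ c hρ.1.1), LCS.twistedD_smul, hconj hβ.1, hβ.2, hdρ]
        exact (congrArg (· + _) (LCS.mulFunLinear _ 2).map_zero).trans (zero_add _)
      refine LCS.exists_quotient_prod_equiv (LCS.mulFunLinear (fun x => Real.exp (h x)) 1)
        (LCS.cocycles θ 1) (LCS.coboundaries θ 1) (LCS.plusCocycles ω ((k : ℝ) • θ) 1)
        (LCS.plusCoboundaries ω ((k : ℝ) • θ) 1) ρ ?_ ?_ ?_
      · intro β hβ c
        have h1 : LCS.mulFun (fun x => Real.exp (h x)) β ∈ LCS.cocycles ((k : ℝ) • θ) 1 := by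
          refine ⟨LCS.mulFun_mem_smoothForms he hβ.1, ?_⟩
          rw [hconj hβ.1, hβ.2]
          exact (LCS.mulFunLinear _ 2).map_zero
        exact add_mem (hclosed _ h1) (Submodule.smul_mem _ c hρ)
      · intro β hβ c
        have hβB : β ∈ LCS.coboundaries θ 1 ↔
            LCS.mulFun (fun x => Real.exp (h x)) β ∈ LCS.coboundaries ((k : ℝ) • θ) 1 := by
          rw [hB, LCS.mulFun_exp_neg_mulFun_exp]
        rw [hcob, hβB]
        constructor
        · intro hm
          -- If `e^h β + c ρ = d_k g`, applying `d_k` gives `c e^h ω = 0`, and `ω` vanishes at no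
          -- point.
          have hc : c = 0 := by
            obtain ⟨γ, hγ, h1⟩ := hm
            obtain ⟨g, hg, rfl⟩ := LCS.exists_eq_ofFun hγ
            have h2 := (hdsum β hβ c).symm.trans
              ((congrArg _ h1.symm).trans (LCS.twistedD_twistedD_ofFun hη hdη hg))
            obtain ⟨x₀⟩ := (inferInstance : Nonempty M)
            have h3 := hω.eq_zero_of_smul_form hn1 (f := fun x => c * Real.exp (h x))
              ((funext fun x => mul_smul c _ (ω x)).trans h2) x₀
            exact (mul_eq_zero.1 h3).resolve_right (Real.exp_pos _).ne'
          subst hc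
          rw [zero_smul, add_zero] at hm
          exact ⟨hm, rfl⟩
        · rintro ⟨hm, rfl⟩
          rw [zero_smul, add_zero]
          exact hm
      · intro α hα
        obtain ⟨c, hc⟩ := hcoef α hα
        have hs : α + (-c) • ρ ∈ LCS.smoothForms n M 1 :=
          add_mem hα.1.1 (Submodule.smul_mem _ _ hρ.1.1)
        -- With `c` from `hcoef`, the form `α - c ρ` is `d_k`-closed, so `e^{-h}` times it is
        -- `d_θ`-closed.
        refine ⟨LCS.mulFun (fun x => Real.exp (-h x)) (α + (-c) • ρ),
          ⟨LCS.mulFun_mem_smoothForms hen hs, ?_⟩, c, ?_⟩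
        · rw [hconj' hs, LCS.twistedD_add _ hα.1.1 (Submodule.smul_mem _ _ hρ.1.1),
            LCS.twistedD_smul, hc, hdρ, neg_smul, add_neg_cancel]
          exact (LCS.mulFunLinear _ 2).map_zero
        · change α = LCS.mulFun (fun x => Real.exp (h x)) (LCS.mulFun _ _) + c • ρ
          rw [LCS.mulFun_exp_mulFun_exp_neg]
          module
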